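/- Let $F$ be a field of characteristic zero, let $m\ge 2$ be an integer, and let $w=w_1w_2\cdots$ be an infinite word in the alphabet $\{0,1\}$ which is either periodic (there is $T\ge 1$ with $w_{i+T}=w_i$ for all $i$) or Sturmian (for every $n\ge 1$ it has exactly $n+1$ distinct subwords of length $n$). Let $\alpha=\lim_{n\to\infty}\frac{w_1+\cdots+w_n}{n}$ be its slope. Put $k_i=m+w_i$ and let $A=A(m,w)$ be the nonassociative $F$-algebra with basis $\{a,b,z^{(i)}_j : i\ge 1,\ 1\le j\le k_i\}$ and multiplication $$z^{(i)}_j a=z^{(i)}_{j+1}\ (1\le j<k_i),\qquad z^{(i)}_{k_i}b=z^{(i+1)}_1 ,$$ all other products of basis elements being zero. For an $F$-algebra $B$ let $c_n(B)=\dim P_n/(P_n\cap \mathrm{Id}(B))$, where $P_n$ is the space of multilinear polynomials in $x_1,\dots,x_n$ in the absolutely free (nonassociative) algebra and $\mathrm{Id}(B)$ is the ideal of polynomial identities of $B$. If $B=B_0\oplus B_1$ is $\mathbb Z_2$-graded, let $c_{k,l}(B)=\dim P_{k,l}/(P_{k,l}\cap \mathrm{Id}^{gr}(B))$, where $P_{k,l}$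 is the space of multilinear polynomials in even variables $x_1,\dots,x_k$ and odd variables $y_1,\dots,y_l$ and $\mathrm{Id}^{gr}(B)$ consists of the polynomials that vanish whenever the even variables are replaced by elements of $B_0$ and the odd ones by elements of $B_1$; put $c_n^{gr}(B)=\sum_{k=0}^n\binom nk c_{k,n-k}(B)$. Let $\exp(B)=\lim_n\sqrt[n]{c_n(B)}$ and $\exp^{gr}(B)=\lim_n\sqrt[n]{c^{gr}_n(B)}$ when these limits exist. Suppose that $A=A_0\oplus A_1$ is a $\mathbb Z_2$-grading of $A$ such that $a$, $b$ and $z^{(1)}_1$ are homogeneous. Then $\exp^{gr}(A)$ and $\exp(A)$ exist and $$\exp^{gr}(A)=\exp(A)=\Phi\Bigl(\frac1{m+\alpha}\Bigr),\qquad \Phi(x)=\frac{1}{x^x(1-x)^{1-x}} .$$ Moreover, if $A^\#=F\cdot 1\oplus A$ is the algebra obtained from $A$ by adjoining an external unit, with the induced grading $A^\#_0=F\cdot 1\oplus A_0$, $A^\#_1=A_1$, then $\exp^{gr}(A^\#)$ also exists and $\exp^{gr}(A^\#)=\exp^{gr}(A)+1$. -/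

import Mathlib

open Filter Topology

noncomputable section

namespace PIAlg

/-! ### Polynomial identities, graded identities and codimensions -/

/-- The multiset of letters (with multiplicity) of a nonassociative monomial. -/
def letters {X : Type*} : FreeMagma X → Multiset X
  | .of x => {x}
  | .mul s t => letters s + letters t

/-- The space of polynomials of the absolutely free algebra `F{X}` which are multilinear in the
variables from `s`: the span of all nonassociative monomials in which every variable from `s`
occurs exactly once and no other variable occurs. -/
def multilinear (F : Type*) [Field F] {X : Type*} (s : Finset X) :
    Submodule F (FreeNonUnitalNonAssocAlgebra F X) :=
  Submodule.span F {f | ∃ t : FreeMagma X, letters t = s.val ∧ f = MonoidAlgebra.ofMagma F _ t}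

section Codim

variable (F : Type*) [Field F]
variable (A : Type*) [NonUnitalNonAssocRing A] [Module F A] [IsScalarTower F A A]
  [SMulCommClass F A A]

/-- `Id(A)`: the polynomials in the free algebra on countably many variables that vanish under
every substitution of elements of `A`. -/
def identities : Submodule F (FreeNonUnitalNonAssocAlgebra F ℕ) where
  carrier := {f | ∀ φ : ℕ → A, FreeNonUnitalNonAssocAlgebra.lift F φ f = 0}
  zero_mem' := fun φ => map_zero _
  add_mem' := fun {f g} hf hg φ => by rw [map_add, hf φ, hg φ, add_zero]
  smul_mem' := fun c f hf φ => by rw [map_smul, hf φ, smul_zero]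

/-- The codimension `c_n(A) = dim P_n / (P_n ∩ Id(A))`. -/
def codim (n : ℕ) : ℕ :=
  Module.finrank F
    (multilinear F (Finset.range n) ⧸ (identities F A).submoduleOf (multilinear F (Finset.range n)))

variable {F A}

/-- `Id^gr(A)`: the polynomials in even variables `Sum.inl i` and odd variables `Sum.inr j` that
vanish under every substitution of elements of `A_0` for the even variables and of elements of
`A_1` for the odd ones. -/
def gradedIdentities (𝒜 : ZMod 2 → Submodule F A) :
    Submodule F (FreeNonUnitalNonAssocAlgebra F (ℕ ⊕ ℕ)) where
  carrier := {f | ∀ φ : ℕ ⊕ ℕ → A, (∀ i, φ (Sum.inl i) ∈ 𝒜 0) → (∀ j, φ (Sum.inr j) ∈ 𝒜 1) →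
    FreeNonUnitalNonAssocAlgebra.lift F φ f = 0}
  zero_mem' := fun φ _ _ => map_zero _
  add_mem' := fun {f g} hf hg φ h0 h1 => by rw [map_add, hf φ h0 h1, hg φ h0 h1, add_zero]
  smul_mem' := fun c f hf φ h0 h1 => by rw [map_smul, hf φ h0 h1, smul_zero]

/-- The variables `x_1, …, x_k` (even) and `y_1, …, y_l` (odd). -/
def gradedVars (k l : ℕ) : Finset (ℕ ⊕ ℕ) := (Finset.range k).disjSum (Finset.range l)

/-- The partial graded codimension `c_{k,l}(A) = dim P_{k,l} / (P_{k,l} ∩ Id^gr(A))`. -/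
def partialCodim (𝒜 : ZMod 2 → Submodule F A) (k l : ℕ) : ℕ :=
  Module.finrank F
    (multilinear F (gradedVars k l) ⧸
      (gradedIdentities 𝒜).submoduleOf (multilinear F (gradedVars k l)))

/-- The graded codimension `c_n^gr(A) = ∑_{k=0}^n (n choose k) c_{k,n-k}(A)`. -/
def gradedCodim (𝒜 : ZMod 2 → Submodule F A) (n : ℕ) : ℕ :=
  ∑ k ∈ Finset.range (n + 1), n.choose k * partialCodim 𝒜 k (n - k)

end Codim

/-- The limit of the `n`-th roots of the sequence `c` exists and is equal to `E`. -/
def HasExponent (c : ℕ → ℕ) (E : ℝ) : Prop :=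
  Tendsto (fun n : ℕ => (c n : ℝ) ^ (1 / (n : ℝ))) atTop (𝓝 E)

/-- `Φ(x) = 1 / (x^x (1-x)^(1-x))`. -/
def Phi (x : ℝ) : ℝ := 1 / (x ^ x * (1 - x) ^ (1 - x))

/-! ### Adjoining an external unit -/

section Unit

variable {F : Type*} [Field F] {A : Type*} [NonUnitalNonAssocRing A] [Module F A]
  [IsScalarTower F A A] [SMulCommClass F A A]

instance unitization_isScalarTower :
    IsScalarTower F (Unitization F A) (Unitization F A) where
  smul_assoc r x y := by
    ext
    · simp [mul_assoc]
    · simp [smul_add, mul_smul, smul_mul_assoc, smul_comm r]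

instance unitization_smulCommClass :
    SMulCommClass F (Unitization F A) (Unitization F A) where
  smul_comm r x y := by
    ext
    · simp [mul_left_comm]
    · simp [smul_add, smul_smul, mul_smul_comm, mul_comm]

/-- The grading induced on `A^# = F·1 ⊕ A`: `(A^#)_0 = F·1 ⊕ A_0` and `(A^#)_1 = A_1`. -/
def unitGrading (𝒜 : ZMod 2 → Submodule F A) (i : ZMod 2) : Submodule F (Unitization F A) :=
  (𝒜 i).map (Unitization.inrHom F F A) ⊔ (if i = 0 then Submodule.span F {1} else ⊥)

end Unit

/-! ### Infinite binary words (the letter `w_{i+1}` is `w i`) -/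

/-- The number of distinct subwords of length `n` of the word `w`. -/
def complexity (w : ℕ → Fin 2) (n : ℕ) : ℕ :=
  (Set.range fun (i : ℕ) (j : Fin n) => w (i + j)).ncard

/-- A word is Sturmian if it has exactly `n + 1` distinct subwords of each length `n ≥ 1`. -/
def IsSturmian (w : ℕ → Fin 2) : Prop := ∀ n, 1 ≤ n → complexity w n = n + 1

/-- A word is periodic if it has a positive period. -/
def IsPeriodic (w : ℕ → Fin 2) : Prop := ∃ T : ℕ, 0 < T ∧ Function.Periodic w T

/-- `α` is the slope of `w`: the limit of `(w_1 + ⋯ + w_n) / n`. -/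
def HasSlope (w : ℕ → Fin 2) (α : ℝ) : Prop :=
  Tendsto (fun n : ℕ => (∑ i ∈ Finset.range n, ((w i : ℕ) : ℝ)) / (n : ℝ)) atTop (𝓝 α)

/-! ### The algebras `A(K)` and `A(m, w)` -/

/-- The basis `a, b, z_j^{(i)}` of `A(K)`. Both indices are counted from `0` here, so
`z i j` is the basis element `z_{j+1}^{(i+1)}`, and `K i` is the integer `k_{i+1}`. -/
inductive Idx (K : ℕ → ℕ) : Type
  | a : Idx K
  | b : Idx K
  | z (i : ℕ) (j : Fin (K i)) : Idx K

/-- The vector space `A(K)`, with basis indexed by `Idx K`. -/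
def Alg (F : Type*) [Field F] (K : ℕ → ℕ) : Type _ := Idx K →₀ F

namespace Alg

variable (F : Type*) [Field F] (K : ℕ → ℕ)

instance : AddCommGroup (Alg F K) := inferInstanceAs (AddCommGroup (Idx K →₀ F))

instance : Module F (Alg F K) := inferInstanceAs (Module F (Idx K →₀ F))

/-- The standard basis of `A(K)`. -/
def basis : Module.Basis (Idx K) F (Alg F K) :=
  Module.Basis.ofRepr (LinearEquiv.refl F (Idx K →₀ F) : Alg F K ≃ₗ[F] (Idx K →₀ F))

/-- The generator `a`. -/
def a : Alg F K := basis F K .a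

/-- The generator `b`. -/
def b : Alg F K := basis F K .b

/-- The element `z_{j+1}^{(i+1)}`; it is `0` by convention for `j` outside the range of indices. -/
def z (i j : ℕ) : Alg F K := if h : j < K i then basis F K (.z i ⟨j, h⟩) else 0

/-- The multiplication table: `z_j^{(i)} a = z_{j+1}^{(i)}` for `j < k_i`,
`z_{k_i}^{(i)} b = z_1^{(i+1)}`, and all other products are zero. -/
def table : Idx K → Idx K → Alg F K
  | .z i j, .a => z F K i (j + 1)
  | .z i j, .b => if (j : ℕ) + 1 = K i then z F K (i + 1) 0 else 0
  | _, _ => 0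

/-- The bilinear multiplication of `A(K)` given by the multiplication table. -/
def mulHom : Alg F K →ₗ[F] Alg F K →ₗ[F] Alg F K :=
  (basis F K).constr F fun x => (basis F K).constr F fun y => table F K x y

instance : NonUnitalNonAssocRing (Alg F K) where
  mul x y := mulHom F K x y
  left_distrib x y w := map_add (mulHom F K x) y w
  right_distrib x y w := LinearMap.map_add₂ (mulHom F K) x y w
  zero_mul x := LinearMap.map_zero₂ (mulHom F K) x
  mul_zero x := map_zero (mulHom F K x)

instance : IsScalarTower F (Alg F K) (Alg F K) where
  smul_assoc r x y := LinearMap.map_smul₂ (mulHom F K) r x y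

instance : SMulCommClass F (Alg F K) (Alg F K) where
  smul_comm r x y := (map_smul (mulHom F K x) r y).symm

end Alg

/-- The sequence `k_i = m + w_i`. -/
def wordSeq (m : ℕ) (w : ℕ → Fin 2) (i : ℕ) : ℕ := m + (w i : ℕ)

/-- The algebra `A(m, w)`. -/
abbrev WordAlg (F : Type*) [Field F] (m : ℕ) (w : ℕ → Fin 2) : Type _ := Alg F (wordSeq m w)

end PIAlg

end

/-!
The basis elements `z i j` form a single chain `u 0, u 1, …`, in which each `u t` is moved to
`u (t + 1)` by exactly one of the two generators: by `b` at the end of a block and by `a` elsewhere.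
Let `c` be the resulting two-letter word. A multilinear monomial that is not left-normed vanishes
in the algebra, and a left-normed one survives only if an element of the chain comes first and
the following factors spell a subword of `c`. So a substitution of basis elements matters only
through the variable sent to the chain, the set of variables sent to `b`, and the subword of `c`
which is read. Hence, up to polynomial factors, the `n`-th codimension is the largest binomial
coefficient `n.choose k`, where `k` is the number of block ends in a subword of length `n`.

A periodic or Sturmian word is balanced (`IsSturmian.isBalanced`, the theorem of Morse and Hedlund)
and has linearly many subwords. Therefore `c` has linearly many subwords of each length
(`card_subwords_le`), and each of them has `n / (m + α) + O(1)` block ends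
(`abs_trues_sub_le`). Since `n.choose k` is `Phi (k / n) ^ n` up to a polynomial factor, this
gives the exponent `Phi (1 / (m + α))`.

All computations are made in the algebra with unit, where a variable may also be sent to `1`; the
identities of the original algebra are those for substitutions that avoid `1`. If `j` variables
are not sent to `1` or to the chain, these can be chosen in about `n.choose j` ways, and the sum
of `n.choose j * Phi p ^ j` over `j` is `(1 + Phi p) ^ n`. The upper bound `IsChain.finrank_le`
counts substitutions up to the equivalence above. The lower bound `IsChain.card_le_finrank` comes
from left-normed commutators `[…[[x₀, y₁], y₂], …, yⱼ]`: on a chain element they act as the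
left-normed product, but they vanish when some `yᵢ` is `1`, so that after multiplication by the
remaining variables they form a dual basis to the substitutions with `j` fixed.

For a grading with `a`, `b` and `z 0 0` homogeneous all basis elements are homogeneous, and each
substitution of basis elements is admissible for exactly one choice of parities of the variables.
Summing over the parities gives the same bounds for the graded codimensions.
-/

noncomputable section

namespace PIAlg

/-! ### Balance and slope of binary words -/

/-- The subword of length `n` of `w` at position `i`. -/
def window (w : ℕ → Fin 2) (n i : ℕ) : Fin n → Fin 2 := fun j => w (i + j)

/-- The number of letters `1` in the subword of length `n` at position `i`. -/
def ones (w : ℕ → Fin 2) (i n : ℕ) : ℕ := ∑ l ∈ Finset.range n, (w (i + l) : ℕ)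

/-- The numbers of letters `1` in two subwords of the same length differ by at most `C`. -/
def IsBalanced (C : ℕ) (w : ℕ → Fin 2) : Prop := ∀ i j n, ones w i n ≤ ones w j n + C

variable {w : ℕ → Fin 2}

lemma window_eq_iff {n i j : ℕ} :
    window w n i = window w n j ↔ ∀ l, l < n → w (i + l) = w (j + l) :=
  ⟨fun h l hl => congrFun h ⟨l, hl⟩, fun h => funext fun l => h l l.2⟩

lemma window_succ_eq_iff {n i j : ℕ} :
    window w (n + 1) i = window w (n + 1) j ↔
      window w n i = window w n j ∧ w (i + n) = w (j + n) := by
  simp only [window_eq_iff]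
  constructor
  · intro h
    exact ⟨fun l hl => h l (by omega), h n (by omega)⟩
  · rintro ⟨h, h'⟩ l hl
    rcases Nat.lt_succ_iff_lt_or_eq.mp hl with hl | rfl
    · exact h l hl
    · exact h'

lemma complexity_eq (n : ℕ) : complexity w n = (Set.range (window w n)).ncard := rfl

/-- A word whose windows of lengths `n` and `n + 1` are equally numerous extends every window of
length `n` in only one way; a Sturmian word does not. -/
lemma IsSturmian.exists_rightSpecial (h : IsSturmian w) {n : ℕ} (hn : 1 ≤ n) :
    ∃ p q, window w n p = window w n q ∧ w (p + n) ≠ w (q + n) := by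
  by_contra! hcon
  have h1 : complexity w (n + 1) ≤ complexity w n := by
    rw [complexity_eq, complexity_eq]
    refine Set.ncard_le_ncard_of_injOn (fun x j => x j.castSucc) ?_ ?_ (Set.toFinite _)
    · rintro _ ⟨i, rfl⟩
      exact ⟨i, rfl⟩
    · rintro _ ⟨i, rfl⟩ _ ⟨j, rfl⟩ hij
      have hij' : window w n i = window w n j := hij
      exact window_succ_eq_iff.mpr ⟨hij', hcon i j hij'⟩
  rw [h n hn, h (n + 1) (by omega)] at h1
  omega

/-- A Sturmian word has at most one window of each length that is followed by both letters. -/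
lemma IsSturmian.rightSpecial_unique (h : IsSturmian w) {n : ℕ} {p q p' q' : ℕ}
    (h1 : window w n p = window w n q) (h2 : w (p + n) ≠ w (q + n))
    (h1' : window w n p' = window w n q') (h2' : w (p' + n) ≠ w (q' + n)) :
    window w n p = window w n p' := by
  rcases Nat.eq_zero_or_pos n with rfl | hn
  · exact Subsingleton.elim _ _
  by_contra hne
  have hsub : ({window w (n + 1) p, window w (n + 1) p'} : Set (Fin (n + 1) → Fin 2)) ⊆
      Set.range (window w (n + 1)) := by
    rintro _ (rfl | rfl)
    exacts [⟨_, rfl⟩, ⟨_, rfl⟩]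
  have hne' : window w (n + 1) p ≠ window w (n + 1) p' :=
    fun e => hne (window_succ_eq_iff.mp e).1
  have hcard := Set.ncard_sdiff hsub (Set.toFinite _)
  rw [Set.ncard_pair hne', ← complexity_eq, h (n + 1) (by omega)] at hcard
  -- the remaining windows of length `n + 1` still restrict to all windows of length `n`
  have hle : (Set.range (window w n)).ncard ≤
      (Set.range (window w (n + 1)) \ {window w (n + 1) p, window w (n + 1) p'}).ncard := by
    have himg : Set.range (window w n) ⊆ (fun (x : Fin (n + 1) → Fin 2) (j : Fin n) =>
        x j.castSucc) ''
        (Set.range (window w (n + 1)) \ {window w (n + 1) p, window w (n + 1) p'}) := by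
      rintro _ ⟨i, rfl⟩
      by_cases hp : window w n i = window w n p
      · refine ⟨window w (n + 1) q, ⟨⟨q, rfl⟩, ?_⟩, (hp.trans h1).symm⟩
        rintro (e | e)
        · exact h2 (window_succ_eq_iff.mp e).2.symm
        · exact hne (h1.trans (window_succ_eq_iff.mp e).1)
      by_cases hp' : window w n i = window w n p'
      · refine ⟨window w (n + 1) q', ⟨⟨q', rfl⟩, ?_⟩, (hp'.trans h1').symm⟩
        rintro (e | e)
        · exact hne ((window_succ_eq_iff.mp e).1.symm.trans h1'.symm)
        · exact h2' (window_succ_eq_iff.mp e).2.symm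
      · refine ⟨window w (n + 1) i, ⟨⟨i, rfl⟩, ?_⟩, rfl⟩
        rintro (e | e)
        · exact hp (window_succ_eq_iff.mp e).1
        · exact hp' (window_succ_eq_iff.mp e).1
    exact (Set.ncard_le_ncard himg (Set.toFinite _)).trans (Set.ncard_image_le (Set.toFinite _))
  rw [← complexity_eq, h n hn] at hle
  omega

lemma complexity_le_of_eventually_periodic {a d : ℕ} (hd : 0 < d)
    (h : ∀ s, w (a + s) = w (a + s + d)) (n : ℕ) : complexity w n ≤ a + d := by
  have key : ∀ i, ∃ i' < a + d, window w n i = window w n i' := by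
    intro i
    induction i using Nat.strong_induction_on with
    | _ i ih =>
      by_cases hi : i < a + d
      · exact ⟨i, hi, rfl⟩
      · obtain ⟨i', hi', e⟩ := ih (i - d) (by omega)
        refine ⟨i', hi', Eq.trans ?_ e⟩
        refine window_eq_iff.mpr fun l _ => ?_
        have := h (i - d - a + l)
        rw [show a + (i - d - a + l) = i - d + l by omega,
          show i - d + l + d = i + l by omega] at this
        exact this.symm
  have hsub : Set.range (window w n) ⊆ (window w n) '' (Finset.range (a + d) : Set ℕ) := by
    rintro _ ⟨i, rfl⟩
    obtain ⟨i', hi', e⟩ := key i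
    exact ⟨i', by simpa using hi', e.symm⟩
  calc complexity w n ≤ ((window w n) '' (Finset.range (a + d) : Set ℕ)).ncard :=
        Set.ncard_le_ncard hsub (Set.toFinite _)
    _ ≤ (Finset.range (a + d) : Set ℕ).ncard := Set.ncard_image_le (Set.toFinite _)
    _ = a + d := by rw [Set.ncard_coe_finset, Finset.card_range]

/-- Let `v` be a palindrome such that `xvx` and `yvy` occur in a Sturmian word, `x ≠ y`. Then `yv`
is not the right special factor of its length: otherwise no window of length `|v| + 1` meeting the
occurrence of `xvx` is right special, two of these windows coincide, and the word is eventually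
periodic. -/
lemma IsSturmian.not_rightSpecial_of_palindrome (h : IsSturmian w) {L i j : ℕ}
    (h0 : w i ≠ w j) (hmid : ∀ l < L, w (i + 1 + l) = w (j + 1 + l))
    (hend : w (i + L + 1) = w i)
    (hpal : ∀ l < L, w (i + 1 + l) = w (i + 1 + (L - 1 - l)))
    (hdet : ∀ p q, window w (L + 1) p = window w (L + 1) q → window w (L + 1) p ≠
      window w (L + 1) j → w (p + (L + 1)) = w (q + (L + 1))) : False := by
  -- an occurrence of `yv` overlapping `xvx` would contradict that `v` is a palindrome
  have hne : ∀ k ≤ L + 1, window w (L + 1) (i + k) ≠ window w (L + 1) j := by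
    intro k hk e
    rw [window_eq_iff] at e
    have e0 := e 0 (by omega)
    simp only [add_zero] at e0
    rcases Nat.eq_zero_or_pos k with rfl | hk0
    · exact h0 e0
    rcases hk.lt_or_eq with hk | rfl
    · have e1 := e (L - k + 1) (by omega)
      rw [show i + k + (L - k + 1) = i + L + 1 by omega, hend,
        show j + (L - k + 1) = j + 1 + (L - k) by omega, ← hmid _ (by omega)] at e1
      have e2 := hpal (k - 1) (by omega)
      rw [show i + 1 + (k - 1) = i + k by omega, e0,
        show L - 1 - (k - 1) = L - k by omega] at e2
      exact h0 (e1.trans e2.symm)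
    · rw [← add_assoc, hend] at e0
      exact h0 e0
  obtain ⟨k, hk, k', hk', hkk, e⟩ : ∃ k ∈ Finset.range (L + 2), ∃ k' ∈ Finset.range (L + 2),
      k ≠ k' ∧ window w (L + 1) (i + k) = window w (L + 1) (i + k') := by
    classical
    refine Finset.exists_ne_map_eq_of_card_lt_of_maps_to
      (t := (Set.range (window w (L + 1)) \ {window w (L + 1) j}).toFinite.toFinset) ?_ ?_
    · rw [← Set.ncard_eq_toFinset_card, Set.ncard_sdiff (by
        rintro _ rfl; exact ⟨j, rfl⟩) (Set.toFinite _), Set.ncard_singleton, ← complexity_eq,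
        h _ (by omega), Finset.card_range]
      omega
    · intro k hk
      simp only [Set.Finite.coe_toFinset]
      exact ⟨⟨_, rfl⟩, hne k (by simpa [Nat.lt_succ_iff] using hk)⟩
  wlog hlt : k < k' generalizing k k'
  · exact this k' hk' k hk hkk.symm e.symm (by omega)
  simp only [Finset.mem_range] at hk hk'
  obtain ⟨d, rfl⟩ : ∃ d, k' = k + d := ⟨k' - k, by omega⟩
  -- from here on every window determines the next letter, so the coincidence propagates
  have key : ∀ s, window w (L + 1) (i + k + s) = window w (L + 1) (i + k + s + d) ∧
      window w (L + 1) (i + k + s) ≠ window w (L + 1) j := by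
    intro s
    induction s using Nat.strong_induction_on with
    | _ s ih =>
      rcases s with _ | s
      · exact ⟨by simpa [add_assoc] using e, hne k (by omega)⟩
      · constructor
        · obtain ⟨e1, e2⟩ := ih s (by omega)
          have e3 := hdet _ _ e1 e2
          rw [window_eq_iff] at e1 ⊢
          intro l hl
          rcases Nat.lt_succ_iff_lt_or_eq.mp hl with hl | rfl
          · have := e1 (l + 1) (by omega)
            convert this using 2 <;> omega
          · convert e3 using 2 <;> omega
        · by_cases hs : k + (s + 1) ≤ L + 1
          · rw [add_assoc]
            exact hne _ hs
          · obtain ⟨e1, e2⟩ := ih (s + 1 - d) (by omega)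
            rw [show i + k + (s + 1 - d) + d = i + k + (s + 1) by omega] at e1
            exact e1 ▸ e2
  have := complexity_le_of_eventually_periodic (w := w) (a := i + k) (d := d) (by omega)
    (fun s => by simpa using window_eq_iff.mp (key s).1 0 (by omega)) (i + k + d)
  rw [h _ (by omega)] at this
  omega

lemma ones_succ (i n : ℕ) : ones w i (n + 1) = ones w i n + w (i + n) := Finset.sum_range_succ _ _

lemma ones_add (i m n : ℕ) : ones w i (m + n) = ones w i m + ones w (i + m) n := by
  simp only [ones, Finset.sum_range_add, add_assoc]

lemma ones_one (i : ℕ) : ones w i 1 = w i := by simp [ones]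

lemma ones_zero (i : ℕ) : ones w i 0 = 0 := rfl

lemma ones_le (i n : ℕ) : ones w i n ≤ n := by
  calc ones w i n ≤ ∑ l ∈ Finset.range n, 1 := Finset.sum_le_sum fun l _ => by
        have := (w (i + l)).2; omega
    _ = n := by simp

/-- Sturmian words are balanced (Morse and Hedlund). A shortest pair of subwords violating balance
has the form `1v1`, `0v0` with `v` a palindrome. The right special factor of length `|v| + 1`
extends the one of length `|v|`, which is `v`; so it is `0v` or `1v`, and both are impossible. -/
theorem IsSturmian.isBalanced (h : IsSturmian w) : IsBalanced 1 w := by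
  by_contra hcon
  have hex : ∃ n, ∃ i j, ones w j n + 2 ≤ ones w i n := by
    simp only [IsBalanced, not_forall, not_le] at hcon
    obtain ⟨i, j, n, hn⟩ := hcon
    exact ⟨n, i, j, by omega⟩
  classical
  obtain ⟨i, j, hij⟩ := Nat.find_spec hex
  have hmin : ∀ n < Nat.find hex, ∀ i j, ones w i n ≤ ones w j n + 1 := by
    intro n hn i j
    have := Nat.find_min hex hn
    push Not at this
    have := this i j
    omega
  obtain ⟨L, hL⟩ : ∃ L, Nat.find hex = L + 2 := by
    refine ⟨Nat.find hex - 2, ?_⟩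
    by_contra hlt
    have := ones_le (w := w) i (Nat.find hex)
    omega
  rw [hL] at hij hmin
  -- proper nonempty prefixes of the two subwords differ by exactly one letter `1`
  have hpre : ∀ l, 0 < l → l < L + 2 → ones w i l = ones w j l + 1 := by
    intro l hl0 hl
    have e1 := ones_add (w := w) i l (L + 2 - l)
    have e2 := ones_add (w := w) j l (L + 2 - l)
    rw [show l + (L + 2 - l) = L + 2 by omega] at e1 e2
    have e3 := hmin l hl i j
    have e4 := hmin (L + 2 - l) (by omega) (i + l) (j + l)
    omega
  have hbit : ∀ p, (w p : ℕ) ≤ 1 := fun p => by have := (w p).2; omega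
  have hfirst := hpre 1 (by omega) (by omega)
  rw [ones_one, ones_one] at hfirst
  have hmid : ∀ l < L, w (i + 1 + l) = w (j + 1 + l) := by
    intro l hl
    have e1 := hpre (l + 1) (by omega) (by omega)
    have e2 := hpre (l + 2) (by omega) (by omega)
    rw [ones_succ i (l + 1), ones_succ j (l + 1)] at e2
    rw [show i + 1 + l = i + (l + 1) by omega, show j + 1 + l = j + (l + 1) by omega]
    exact Fin.ext (by omega)
  have hlast : (w (i + L + 1) : ℕ) = 1 ∧ (w (j + L + 1) : ℕ) = 0 := by
    have e1 := hpre (L + 1) (by omega) (by omega)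
    rw [ones_succ i (L + 1), ones_succ j (L + 1)] at hij
    have := hbit (i + (L + 1))
    constructor <;> simp only [add_assoc] at * <;> omega
  -- prefixes and suffixes of `v` of the same length contain equally many letters `1`
  have hps : ∀ l ≤ L, ones w (i + 1) l = ones w (i + 1 + (L - l)) l := by
    intro l hl
    have hmid' : ∀ s t, s + t ≤ L → ones w (i + 1 + s) t = ones w (j + 1 + s) t := by
      intro s t hst
      refine Finset.sum_congr rfl fun x hx => ?_
      rw [Finset.mem_range] at hx
      have := hmid (s + x) (by omega)
      rw [← add_assoc, ← add_assoc] at this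
      rw [this]
    have e1 := hmin (l + 1) (by omega) i (j + 1 + (L - l))
    have e2 := hmin (l + 1) (by omega) (i + 1 + (L - l)) j
    rw [ones_succ (j + 1 + (L - l)), add_comm l 1, ones_add, ones_one] at e1
    rw [ones_succ (i + 1 + (L - l)), add_comm l 1, ones_add j, ones_one] at e2
    rw [show j + 1 + (L - l) + l = j + L + 1 by omega] at e1
    rw [show i + 1 + (L - l) + l = i + L + 1 by omega] at e2
    have e3 := hmid' (L - l) l (by omega)
    have e4 := hmid' 0 l (by omega)
    simp only [add_zero] at e4
    have := hbit i
    omega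
  have hpal : ∀ l < L, w (i + 1 + l) = w (i + 1 + (L - 1 - l)) := by
    intro l hl
    have e1 := hps l (by omega)
    have e2 := hps (l + 1) (by omega)
    rw [ones_succ, add_comm l 1, ones_add, ones_one] at e2
    rw [show i + 1 + (L - (1 + l)) + 1 = i + 1 + (L - l) by omega,
      show L - (1 + l) = L - 1 - l by omega] at e2
    exact Fin.ext (by omega)
  have hne : w i ≠ w j := fun e => by rw [e] at hfirst; omega
  obtain ⟨p, q, hpq, hpq'⟩ := h.exists_rightSpecial (n := L + 1) (by omega)
  have hbit_cases : w p = w i ∨ w p = w j := by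
    have := hbit p
    have := hbit i
    rcases Nat.eq_zero_or_pos (w p : ℕ) with h' | h'
    · right; exact Fin.ext (by omega)
    · left; exact Fin.ext (by omega)
  -- `v` is right special, hence it is the suffix of the right special factor at `p`
  have hpv : window w L (p + 1) = window w L (i + 1) := by
    refine h.rightSpecial_unique (q := q + 1) (q' := j + 1) ?_ ?_ (window_eq_iff.mpr hmid) ?_
    · rw [window_eq_iff] at hpq ⊢
      intro l hl
      have := hpq (l + 1) (by omega)
      convert this using 2 <;> omega
    · rwa [show p + 1 + L = p + (L + 1) by omega, show q + 1 + L = q + (L + 1) by omega]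
    · intro e
      have e' := congrArg Fin.val e
      rw [show i + 1 + L = i + L + 1 by omega, show j + 1 + L = j + L + 1 by omega] at e'
      omega
  have hwin : ∀ r, w p = w r → window w L (p + 1) = window w L (r + 1) →
      window w (L + 1) p = window w (L + 1) r := by
    intro r e0 e1
    rw [window_eq_iff] at e1 ⊢
    intro l hl
    rcases l with _ | l
    · exact e0
    · have := e1 l (by omega)
      convert this using 2 <;> omega
  have hdet : ∀ r, window w (L + 1) p = window w (L + 1) r → ∀ p' q',
      window w (L + 1) p' = window w (L + 1) q' → window w (L + 1) p' ≠ window w (L + 1) r →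
      w (p' + (L + 1)) = w (q' + (L + 1)) := by
    intro r hr p' q' e e'
    by_contra hcon
    exact e' ((h.rightSpecial_unique e hcon hpq hpq').trans hr)
  rcases hbit_cases with hp | hp
  · refine h.not_rightSpecial_of_palindrome (L := L) (i := j) (j := i) hne.symm
      (fun l hl => (hmid l hl).symm) ?_ ?_ (hdet i (hwin i hp hpv))
    · have := hbit i
      exact Fin.ext (by omega)
    · intro l hl
      rw [← hmid l hl, ← hmid (L - 1 - l) (by omega)]
      exact hpal l hl
  · refine h.not_rightSpecial_of_palindrome (L := L) (i := i) (j := j) hne hmid ?_ hpal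
      (hdet j (hwin j hp (hpv.trans (window_eq_iff.mpr hmid))))
    have := hbit i
    exact Fin.ext (by omega)

lemma isBalanced_of_periodic {T : ℕ} (hT : 0 < T) (h : Function.Periodic w T) :
    IsBalanced T w := by
  have h1 : ∀ i, ones w i T = ones w 0 T := by
    intro i
    induction i with
    | zero => rfl
    | succ i ih =>
      have e1 := ones_succ (w := w) i T
      have e2 := ones_add (w := w) i 1 T
      rw [ones_one, add_comm 1 T] at e2
      rw [h i] at e1
      omega
  intro i j n
  induction n using Nat.strong_induction_on generalizing i j with
  | _ n ih =>
    by_cases hn : n < T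
    · have := ones_le (w := w) i n
      omega
    · have e := ih (n - T) (by omega) (i + T) (j + T)
      have e1 := ones_add (w := w) i T (n - T)
      have e2 := ones_add (w := w) j T (n - T)
      rw [show T + (n - T) = n by omega, h1] at e1 e2
      omega

lemma exists_isBalanced (hw : IsPeriodic w ∨ IsSturmian w) : ∃ C, IsBalanced C w := by
  rcases hw with ⟨T, hT, h⟩ | h
  · exact ⟨T, isBalanced_of_periodic hT h⟩
  · exact ⟨1, h.isBalanced⟩

lemma exists_complexity_le (hw : IsPeriodic w ∨ IsSturmian w) :
    ∃ C, ∀ n, complexity w n ≤ C * (n + 1) := by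
  rcases hw with ⟨T, hT, h⟩ | h
  · refine ⟨T, fun n => ?_⟩
    have := complexity_le_of_eventually_periodic (w := w) (a := 0) hT
      (fun s => by rw [zero_add]; exact (h s).symm) n
    nlinarith
  · refine ⟨1, fun n => ?_⟩
    rcases Nat.eq_zero_or_pos n with rfl | hn
    · have : (Set.range (window w 0)).Subsingleton := fun x _ y _ => Subsingleton.elim x y
      simpa [complexity_eq] using (Set.ncard_le_one_iff_subsingleton.mpr this)
    · rw [h n hn, one_mul]

/-- In a balanced word of slope `α`, the letter `1` has frequency `α` uniformly over subwords. -/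
lemma IsBalanced.abs_ones_sub_le {C : ℕ} (h : IsBalanced C w) {α : ℝ} (hα : HasSlope w α)
    (i n : ℕ) : |(ones w i n : ℝ) - n * α| ≤ C := by
  rcases Nat.eq_zero_or_pos n with rfl | hn
  · simp [ones_zero]
  have hn' : (0 : ℝ) < n := by exact_mod_cast hn
  have hblock : ∀ q : ℕ, |(ones w 0 (n * q) : ℝ) - q * ones w i n| ≤ q * C := by
    intro q
    induction q with
    | zero => simp [ones_zero]
    | succ q ih =>
      rw [mul_add_one, ones_add]
      have e1 : (ones w i n : ℝ) ≤ ones w (0 + n * q) n + C := by exact_mod_cast h _ _ _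
      have e2 : (ones w (0 + n * q) n : ℝ) ≤ ones w i n + C := by exact_mod_cast h _ _ _
      rw [abs_le] at ih ⊢
      push_cast
      constructor <;> nlinarith
  have hlim : Tendsto (fun q : ℕ => (ones w 0 (n * q) : ℝ) / ((n * q : ℕ) : ℝ)) atTop (𝓝 α) := by
    have h1 : Tendsto (fun q : ℕ => n * q) atTop atTop :=
      tendsto_id.const_mul_atTop' hn
    refine (hα.comp h1).congr fun q => ?_
    simp [ones, Function.comp]
  have hlim2 : Tendsto (fun q : ℕ => |(ones w i n : ℝ) -
      n * ((ones w 0 (n * q) : ℝ) / ((n * q : ℕ) : ℝ))|) atTop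
      (𝓝 |(ones w i n : ℝ) - n * α|) := (tendsto_const_nhds.sub (hlim.const_mul _)).abs
  refine le_of_tendsto hlim2 ?_
  filter_upwards [eventually_gt_atTop 0] with q hq
  have hq' : (0 : ℝ) < q := by exact_mod_cast hq
  have e : (ones w i n : ℝ) - n * ((ones w 0 (n * q) : ℝ) / ((n * q : ℕ) : ℝ)) =
      -(((ones w 0 (n * q) : ℝ) - q * ones w i n) / q) := by
    push_cast
    field_simp
    ring
  rw [e, abs_neg, abs_div, abs_of_pos hq', div_le_iff₀ hq', mul_comm (C : ℝ)]
  exact hblock q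

lemma HasSlope.nonneg {α : ℝ} (hα : HasSlope w α) : 0 ≤ α :=
  ge_of_tendsto' hα fun n => by positivity

/-! ### The word along the chain of basis elements -/

/-- The subword of length `n` of the Boolean word `c` at position `t`. -/
def word (c : ℕ → Bool) (t n : ℕ) : List Bool := (List.range n).map fun l => c (t + l)

/-- The number of letters `true` in the subword of length `n` at position `t`. -/
def trues (c : ℕ → Bool) (t n : ℕ) : ℕ := (word c t n).count true

/-- The subwords of length `n` of a Boolean word. -/
def subwords (c : ℕ → Bool) (n : ℕ) : Finset (List Bool) :=
  (show (Set.range fun t => word c t n).Finite from (List.finite_length_eq Bool n).subset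
    (by rintro _ ⟨t, rfl⟩; simp [word])).toFinset

lemma mem_subwords {c : ℕ → Bool} {n : ℕ} {W : List Bool} :
    W ∈ subwords c n ↔ ∃ t, word c t n = W := by
  simp [subwords]

lemma length_word (c : ℕ → Bool) (t n : ℕ) : (word c t n).length = n := by simp [word]

lemma word_succ (c : ℕ → Bool) (t n : ℕ) : word c t (n + 1) = word c t n ++ [c (t + n)] := by
  simp [word, List.range_succ]

lemma word_eq_word_iff {c d : ℕ → Bool} {t s n : ℕ} :
    word c t n = word d s n ↔ ∀ l < n, c (t + l) = d (s + l) := by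
  simp [word]

@[simp] lemma trues_zero (c : ℕ → Bool) (t : ℕ) : trues c t 0 = 0 := rfl

lemma trues_succ (c : ℕ → Bool) (t n : ℕ) :
    trues c t (n + 1) = trues c t n + if c (t + n) then 1 else 0 := by
  rw [trues, word_succ, List.count_append, trues]
  cases c (t + n) <;> simp

lemma trues_le (c : ℕ → Bool) (t n : ℕ) : trues c t n ≤ n := by
  exact List.count_le_length.trans_eq (length_word c t n)

section Position

variable (K : ℕ → ℕ)

/-- The block `i` and the index `j` in it of the `t`-th element of the sequence
`z 0 0, z 0 1, …, z 0 (K 0 - 1), z 1 0, …`. -/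
def position : ℕ → ℕ × ℕ
  | 0 => (0, 0)
  | t + 1 => if (position t).2 + 1 = K (position t).1 then ((position t).1 + 1, 0)
      else ((position t).1, (position t).2 + 1)

/-- Whether the `t`-th element of the sequence `z 0 0, z 0 1, …` is the last one of its block. -/
def isLast (t : ℕ) : Bool := decide ((position K t).2 + 1 = K (position K t).1)

variable {K}

lemma position_lt (hK : ∀ i, 0 < K i) (t : ℕ) : (position K t).2 < K (position K t).1 := by
  induction t with
  | zero => exact hK 0
  | succ t ih =>
    rw [position]
    split_ifs
    · exact hK _
    · change (position K t).2 + 1 < K (position K t).1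
      omega

lemma sum_position (t : ℕ) :
    ∑ l ∈ Finset.range (position K t).1, K l + (position K t).2 = t := by
  induction t with
  | zero => rfl
  | succ t ih =>
    rw [position]
    split_ifs with h
    · change ∑ l ∈ Finset.range ((position K t).1 + 1), K l + 0 = t + 1
      rw [Finset.sum_range_succ]
      omega
    · change ∑ l ∈ Finset.range (position K t).1, K l + ((position K t).2 + 1) = t + 1
      omega

lemma exists_position_eq (hK : ∀ i, 0 < K i) (i j : ℕ) (hj : j < K i) :
    ∃ t, position K t = (i, j) := by
  induction i generalizing j with
  | zero =>
    induction j with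
    | zero => exact ⟨0, rfl⟩
    | succ j ih =>
      obtain ⟨t, ht⟩ := ih (by omega)
      exact ⟨t + 1, by rw [position, ht, if_neg (by dsimp only; omega)]⟩
  | succ i ihi =>
    induction j with
    | zero =>
      have := hK i
      obtain ⟨t, ht⟩ := ihi (K i - 1) (by omega)
      exact ⟨t + 1, by rw [position, ht, if_pos (by dsimp only; omega)]⟩
    | succ j ih =>
      obtain ⟨t, ht⟩ := ih (by omega)
      exact ⟨t + 1, by rw [position, ht, if_neg (by dsimp only; omega)]⟩

lemma position_add_trues (t n : ℕ) :
    (position K (t + n)).1 = (position K t).1 + trues (isLast K) t n := by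
  induction n with
  | zero => rfl
  | succ n ih =>
    rw [← add_assoc, position, trues_succ, isLast]
    split_ifs with h h' h'
    · change (position K (t + n)).1 + 1 = _
      omega
    · simp_all
    · simp_all
    · change (position K (t + n)).1 = _
      omega

end Position

lemma ncard_range_le_of_factorsThrough {ι α β : Type*} {f : ι → α} {g : ι → β}
    (h : ∀ i j, g i = g j → f i = f j) (hg : (Set.range g).Finite) :
    (Set.range f).ncard ≤ (Set.range g).ncard := by
  rcases isEmpty_or_nonempty ι with hι | ⟨⟨i₀⟩⟩
  · simp [Set.range_eq_empty]
  have e : Set.range f = Function.extend g f (fun _ => f i₀) '' Set.range g := by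
    rw [← Set.range_comp]
    congr 1
    funext i
    exact (Function.FactorsThrough.extend_apply (fun i j hij => h i j hij) _ i).symm
  rw [e]
  exact Set.ncard_image_le hg

section WordSeq

variable {m : ℕ} {w : ℕ → Fin 2}

/-- A subword of length `n` of the sequence of block ends is determined by the position in the
block at which it starts and by `n` letters of `w`. -/
lemma card_subwords_le (hm : 0 < m) (n : ℕ) :
    (subwords (isLast (wordSeq m w)) n).card ≤ (m + 1) * complexity w n := by
  have hK : ∀ i, 0 < wordSeq m w i := fun i => by unfold wordSeq; omega
  have e1 : (subwords (isLast (wordSeq m w)) n).card =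
      (Set.range fun t => word (isLast (wordSeq m w)) t n).ncard := by
    rw [← Set.ncard_coe_finset]
    congr 1
    ext W
    simp [mem_subwords]
  set P := position (wordSeq m w) with hP
  have hsub : (Set.range fun t => ((P t).2, window w n (P t).1)) ⊆
      (Finset.range (m + 1) : Set ℕ) ×ˢ Set.range (window w n) := by
    rintro _ ⟨t, rfl⟩
    refine ⟨?_, ⟨_, rfl⟩⟩
    have h1 := position_lt hK t
    have h2 : wordSeq m w (position (wordSeq m w) t).1 ≤ m + 1 := by
      unfold wordSeq
      have := (w (position (wordSeq m w) t).1).2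
      omega
    simp only [Finset.coe_range, Set.mem_Iio]
    exact lt_of_lt_of_le h1 h2
  have hfin : ((Finset.range (m + 1) : Set ℕ) ×ˢ Set.range (window w n)).Finite :=
    (Finset.finite_toSet _).prod (Set.toFinite _)
  have h2 : (Set.range fun t => word (isLast (wordSeq m w)) t n).ncard ≤
      (Set.range fun t => ((P t).2, window w n (P t).1)).ncard := by
    refine ncard_range_le_of_factorsThrough ?_ (hfin.subset hsub)
    intro t s hts
    rw [Prod.mk.injEq, window_eq_iff] at hts
    obtain ⟨hj, hw⟩ := hts
    have key : ∀ l ≤ n, ∃ d ≤ l, (P (t + l)).1 = (P t).1 + d ∧ (P (s + l)).1 = (P s).1 + d ∧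
        (P (t + l)).2 = (P (s + l)).2 := by
      intro l hl
      induction l with
      | zero => exact ⟨0, le_rfl, rfl, rfl, hj⟩
      | succ l ih =>
        obtain ⟨d, hd, e1, e2, e3⟩ := ih (by omega)
        have e4 : wordSeq m w (P (t + l)).1 = wordSeq m w (P (s + l)).1 := by
          rw [e1, e2, wordSeq, wordSeq, hw d (by omega)]
        rw [← add_assoc, ← add_assoc, hP, position, position, ← hP, e4, e3]
        split_ifs
        · exact ⟨d + 1, by omega, by simp [e1, add_assoc], by simp [e2, add_assoc], rfl⟩
        · exact ⟨d, by omega, e1, e2, rfl⟩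
    rw [word_eq_word_iff]
    intro l hl
    obtain ⟨d, hd, e1, e2, e3⟩ := key l hl.le
    have e4 : wordSeq m w (P (t + l)).1 = wordSeq m w (P (s + l)).1 := by
      rw [e1, e2, wordSeq, wordSeq, hw d (by omega)]
    simp only [isLast, ← hP, e3, e4]
  rw [e1]
  refine h2.trans ((Set.ncard_le_ncard hsub hfin).trans_eq ?_)
  rw [Set.ncard_prod, Set.ncard_coe_finset, Finset.card_range]
  rfl

/-- The ends of the blocks have frequency `1 / (m + α)`, uniformly over subwords. -/
lemma abs_trues_sub_le (hm : 0 < m) {C : ℕ} (h : IsBalanced C w) {α : ℝ}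
    (hα : HasSlope w α) (t n : ℕ) :
    |(trues (isLast (wordSeq m w)) t n : ℝ) - n * (1 / (m + α))| ≤ C + m + 1 := by
  have hK : ∀ i, 0 < wordSeq m w i := fun i => by unfold wordSeq; omega
  set P := position (wordSeq m w) with hP
  set q := trues (isLast (wordSeq m w)) t n with hq
  have hle : ∀ t, (P t).2 ≤ m := by
    intro t
    have h1 := position_lt hK t
    have h2 : wordSeq m w (P t).1 ≤ m + 1 := by
      unfold wordSeq
      have := (w (P t).1).2
      omega
    rw [← hP] at h1
    omega
  have e1 := sum_position (K := wordSeq m w) t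
  have e2 := sum_position (K := wordSeq m w) (t + n)
  rw [← hP] at e1 e2
  have e0 : (P (t + n)).1 = (P t).1 + q := position_add_trues t n
  rw [e0, Finset.sum_range_add] at e2
  have e3 : ∑ x ∈ Finset.range q, wordSeq m w ((P t).1 + x) = q * m + ones w (P t).1 q := by
    simp [wordSeq, Finset.sum_add_distrib, ones]
  -- the length is the total size of the `q` completed blocks, up to the two end positions
  have e4 : ((q * m + ones w (P t).1 q + (P (t + n)).2 : ℕ) : ℝ) = ((P t).2 + n : ℕ) := by
    congr 1
    omega
  push_cast at e4
  have b0 := h.abs_ones_sub_le hα (P t).1 q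
  have b1 : ((P t).2 : ℝ) ≤ m := by exact_mod_cast hle t
  have b2 : ((P (t + n)).2 : ℝ) ≤ m := by exact_mod_cast hle (t + n)
  have b3 : (0 : ℝ) ≤ ((P t).2 : ℝ) := by positivity
  have b4 : (0 : ℝ) ≤ ((P (t + n)).2 : ℝ) := by positivity
  have hα0 := hα.nonneg
  have hm1 : (1 : ℝ) ≤ m := by exact_mod_cast hm
  have hpos : 0 < (m : ℝ) + α := by linarith
  have e5 : (q : ℝ) - n * (1 / (m + α)) = (q * (m + α) - n) / (m + α) := by
    field_simp
  rw [e5, abs_div, abs_of_pos hpos, div_le_iff₀ hpos]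
  have b5 : |(q : ℝ) * (m + α) - n| ≤ C + m + 1 := by
    rw [abs_le] at b0 ⊢
    constructor <;> nlinarith
  have hC : (0 : ℝ) ≤ C := by positivity
  nlinarith

end WordSeq

/-! ### Binomial coefficients and exponents -/

lemma Phi_eq_exp_binEntropy {x : ℝ} (h0 : 0 ≤ x) (h1 : x ≤ 1) :
    Phi x = Real.exp (Real.binEntropy x) := by
  have key : ∀ y : ℝ, 0 ≤ y → y ^ y = Real.exp (y * Real.log y) := by
    intro y hy
    rcases hy.eq_or_lt with rfl | hy
    · simp
    · rw [Real.rpow_def_of_pos hy, mul_comm]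
  rw [Phi, key x h0, key (1 - x) (by linarith), ← Real.exp_add, one_div, ← Real.exp_neg,
    Real.binEntropy_eq_negMulLog_add_negMulLog_one_sub, Real.negMulLog, Real.negMulLog]
  congr 1
  ring

lemma one_le_Phi {x : ℝ} (h0 : 0 ≤ x) (h1 : x ≤ 1) : 1 ≤ Phi x := by
  rw [Phi_eq_exp_binEntropy h0 h1]
  exact Real.one_le_exp (Real.binEntropy_nonneg h0 h1)

/-- A single term of the binomial expansion of `(p + (1 - p)) ^ N` is at most `1`; near the mean
this term is `N.choose k / Phi p ^ N` up to a constant factor. -/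
lemma choose_le_mul_Phi_pow {p D : ℝ} (hp0 : 0 < p) (hp : p ≤ 1 / 2) {N k : ℕ} (hk : k ≤ N)
    (hD : |(k : ℝ) - N * p| ≤ D) :
    (N.choose k : ℝ) ≤ ((1 - p) / p) ^ D * Phi p ^ N := by
  have hq0 : 0 < 1 - p := by linarith
  have h1 : (p ^ k * (1 - p) ^ (N - k)) * (N.choose k : ℝ) ≤ 1 := by
    have h := add_pow p (1 - p) N
    rw [add_sub_cancel, one_pow] at h
    refine le_of_le_of_eq ?_ h.symm
    exact Finset.single_le_sum (f := fun i => p ^ i * (1 - p) ^ (N - i) * (N.choose i : ℝ))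
      (fun i _ => by positivity) (Finset.mem_range.mpr (show k < N + 1 by omega))
  have h2 : p ^ k * (1 - p) ^ (N - k) =
      Real.exp (k * Real.log p + (N - k) * Real.log (1 - p)) := by
    rw [Real.exp_add, ← Nat.cast_sub hk, Real.exp_nat_mul, Real.exp_nat_mul, Real.exp_log hp0,
      Real.exp_log hq0]
  have h3 : ((1 - p) / p) ^ D * Phi p ^ N = Real.exp ((Real.log (1 - p) - Real.log p) * D +
      N * (-p * Real.log p - (1 - p) * Real.log (1 - p))) := by
    rw [Real.rpow_def_of_pos (by positivity), Real.log_div hq0.ne' hp0.ne', Real.exp_add,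
      Real.exp_nat_mul, Phi_eq_exp_binEntropy hp0.le (by linarith),
      Real.binEntropy_eq_negMulLog_add_negMulLog_one_sub, Real.negMulLog, Real.negMulLog]
    congr 3
    ring
  have hlog : 0 ≤ Real.log (1 - p) - Real.log p :=
    sub_nonneg.mpr (Real.log_le_log hp0 (by linarith))
  rw [h2] at h1
  rw [h3]
  have h4 : (N.choose k : ℝ) ≤ Real.exp (-(k * Real.log p + (N - k) * Real.log (1 - p))) := by
    rw [Real.exp_neg, ← one_div, le_div_iff₀ (Real.exp_pos _), mul_comm]
    exact h1
  refine h4.trans (Real.exp_le_exp.mpr ?_)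
  have h5 := mul_le_mul_of_nonneg_left ((le_abs_self _).trans hD) hlog
  nlinarith

lemma factorial_mul_pow_le (i k : ℕ) : k.factorial * k ^ i ≤ i.factorial * k ^ k := by
  rcases le_total i k with h | h
  · obtain ⟨d, rfl⟩ := Nat.exists_eq_add_of_le h
    have h1 : (i + d).factorial ≤ i.factorial * (i + d) ^ d := by
      have := Nat.factorial_mul_descFactorial (Nat.le_add_left d i)
      rw [Nat.add_sub_cancel] at this
      rw [← this]
      exact Nat.mul_le_mul_left _ (Nat.descFactorial_le_pow _ _)
    calc (i + d).factorial * (i + d) ^ i ≤ i.factorial * (i + d) ^ d * (i + d) ^ i :=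
          Nat.mul_le_mul_right _ h1
      _ = i.factorial * (i + d) ^ (i + d) := by ring
  · have h1 := Nat.factorial_mul_pow_sub_le_factorial h
    calc k.factorial * k ^ i = k.factorial * k ^ (i - k) * k ^ k := by
          rw [mul_assoc, ← pow_add, Nat.sub_add_cancel h]
      _ ≤ _ := Nat.mul_le_mul_right _ h1

/-- In the binomial expansion of `(k + (N - k)) ^ N` the `k`-th term is the largest. -/
lemma choose_mul_pow_le {N k i : ℕ} (hk : k ≤ N) (hi : i ≤ N) :
    N.choose i * (k ^ i * (N - k) ^ (N - i)) ≤ N.choose k * (k ^ k * (N - k) ^ (N - k)) := by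
  have h1 := factorial_mul_pow_le i k
  have h2 := factorial_mul_pow_le (N - i) (N - k)
  have h3 := Nat.mul_le_mul h1 h2
  have e1 := Nat.choose_mul_factorial_mul_factorial hi
  have e2 := Nat.choose_mul_factorial_mul_factorial hk
  have hpos : 0 < i.factorial * (N - i).factorial * (k.factorial * (N - k).factorial) := by
    positivity
  refine Nat.le_of_mul_le_mul_left ?_ hpos
  calc i.factorial * (N - i).factorial * (k.factorial * (N - k).factorial) *
        (N.choose i * (k ^ i * (N - k) ^ (N - i)))
      = (N.choose i * i.factorial * (N - i).factorial) *
        (k.factorial * k ^ i * ((N - k).factorial * (N - k) ^ (N - i))) := by ring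
    _ ≤ (N.choose i * i.factorial * (N - i).factorial) *
        (i.factorial * k ^ k * ((N - i).factorial * (N - k) ^ (N - k))) :=
        Nat.mul_le_mul_left _ h3
    _ = (N.choose k * k.factorial * (N - k).factorial) *
        (i.factorial * k ^ k * ((N - i).factorial * (N - k) ^ (N - k))) := by rw [e1, e2]
    _ = _ := by ring

lemma Phi_pow_le_choose {N k : ℕ} (hN : 0 < N) (hk : k ≤ N) :
    Phi (k / N) ^ N ≤ (N + 1) * N.choose k := by
  have h1 : N ^ N ≤ (N + 1) * (N.choose k * (k ^ k * (N - k) ^ (N - k))) := by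
    have h := add_pow k (N - k) N
    rw [Nat.add_sub_cancel' hk] at h
    calc N ^ N = _ := h
      _ ≤ ∑ i ∈ Finset.range (N + 1), N.choose k * (k ^ k * (N - k) ^ (N - k)) := by
          refine Finset.sum_le_sum fun i hi => ?_
          rw [mul_comm]
          exact choose_mul_pow_le hk (by simpa [Nat.lt_succ_iff] using hi)
      _ = _ := by simp
  have hN' : (0 : ℝ) < N := by exact_mod_cast hN
  have hx0 : (0 : ℝ) ≤ k / N := by positivity
  have hx1 : (k : ℝ) / N ≤ 1 := by
    rw [div_le_one hN']
    exact_mod_cast hk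
  have key : ∀ i : ℕ, Real.exp (N * Real.negMulLog (i / N)) * (i : ℝ) ^ i = (N : ℝ) ^ i := by
    intro i
    rcases Nat.eq_zero_or_pos i with rfl | hi
    · simp
    have hi' : (0 : ℝ) < i := by exact_mod_cast hi
    have e : N * Real.negMulLog (i / N) = i * Real.log (N / i) := by
      rw [Real.negMulLog, ← inv_div (i : ℝ) (N : ℝ), Real.log_inv]
      field_simp
    rw [e, Real.exp_nat_mul, Real.exp_log (by positivity), ← mul_pow]
    congr 1
    field_simp
  have e1 := key k
  have e2 := key (N - k)
  have e3 : ((N - k : ℕ) : ℝ) / N = 1 - k / N := by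
    rw [Nat.cast_sub hk]
    field_simp
  rw [e3] at e2
  have e4 : Phi (k / N) ^ N * ((k : ℝ) ^ k * ((N - k : ℕ) : ℝ) ^ (N - k)) = (N : ℝ) ^ N := by
    rw [Phi_eq_exp_binEntropy hx0 hx1, ← Real.exp_nat_mul,
      Real.binEntropy_eq_negMulLog_add_negMulLog_one_sub, mul_add, Real.exp_add]
    calc _ = (Real.exp (N * Real.negMulLog (k / N)) * (k : ℝ) ^ k) *
          (Real.exp (N * Real.negMulLog (1 - k / N)) * ((N - k : ℕ) : ℝ) ^ (N - k)) := by ring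
      _ = _ := by rw [e1, e2, ← pow_add, Nat.add_sub_cancel' hk]
  have hpos : 0 < (k : ℝ) ^ k * ((N - k : ℕ) : ℝ) ^ (N - k) := by
    have hself : ∀ i : ℕ, 0 < (i : ℝ) ^ i := by
      intro i
      exact_mod_cast Nat.pow_self_pos
    exact mul_pos (hself _) (hself _)
  have h2 : (N : ℝ) ^ N ≤
      (N + 1) * (N.choose k * ((k : ℝ) ^ k * ((N - k : ℕ) : ℝ) ^ (N - k))) := by
    exact_mod_cast h1
  rw [← e4, ← mul_assoc] at h2
  exact le_of_mul_le_mul_right (by linarith) hpos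

/-- Binomial coefficients `N.choose k` with `k` close to `N * p` grow at least like any geometric
progression of ratio smaller than `Phi p`. -/
lemma exists_mul_pow_le_choose {p D : ℝ} (hp0 : 0 ≤ p) (hp1 : p ≤ 1) {k : ℕ → ℕ}
    (hk : ∀ N, k N ≤ N) (hD : ∀ N, |(k N : ℝ) - N * p| ≤ D) {E : ℝ} (hE0 : 0 < E)
    (hE : E < Phi p) : ∃ δ > 0, ∀ N, δ * E ^ N ≤ N.choose (k N) := by
  obtain ⟨E', hEE', hE'⟩ := exists_between hE
  have hlim : Tendsto (fun N : ℕ => (k N : ℝ) / N) atTop (𝓝 p) := by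
    rw [tendsto_iff_norm_sub_tendsto_zero]
    refine squeeze_zero' (.of_forall fun _ => norm_nonneg _) ?_
      (tendsto_const_div_atTop_nhds_zero_nat D)
    filter_upwards [eventually_gt_atTop 0] with N hN
    have hN' : (0 : ℝ) < N := by exact_mod_cast hN
    have e : (k N : ℝ) / N - p = (k N - N * p) / N := by field_simp
    rw [e, Real.norm_eq_abs, abs_div, abs_of_pos hN']
    exact div_le_div_of_nonneg_right (hD N) hN'.le
  have h1 : ∀ᶠ N : ℕ in atTop, E' < Phi (k N / N) := by
    have h := ((Real.continuous_exp.comp Real.binEntropy_continuous).tendsto p).comp hlim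
    simp only [Function.comp_apply, ← Phi_eq_exp_binEntropy hp0 hp1] at h
    filter_upwards [h.eventually (lt_mem_nhds hE'), eventually_gt_atTop 0] with N h2 hN
    have hN' : (0 : ℝ) < N := by exact_mod_cast hN
    rwa [Phi_eq_exp_binEntropy (by positivity) (by
      rw [div_le_one hN']
      exact_mod_cast hk N)]
  have h2 : ∀ᶠ N : ℕ in atTop, ((N : ℝ) + 1) * E ^ N ≤ E' ^ N := by
    have hr : |E / E'| < 1 := by
      rw [abs_of_pos (by have := hE0.trans hEE'; positivity), div_lt_one (hE0.trans hEE')]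
      exact hEE'
    have h3 : Tendsto (fun N : ℕ => (N : ℝ) * (E / E') ^ N + (E / E') ^ N) atTop (𝓝 (0 + 0)) :=
      (tendsto_self_mul_const_pow_of_abs_lt_one hr).add
        (tendsto_pow_atTop_nhds_zero_of_abs_lt_one hr)
    rw [add_zero] at h3
    filter_upwards [h3.eventually (gt_mem_nhds one_pos)] with N hN
    have hpos : 0 < E' ^ N := pow_pos (hE0.trans hEE') N
    rw [div_pow, ← add_one_mul, ← mul_div_assoc, div_lt_one hpos] at hN
    exact hN.le
  -- `δ` takes care of the finitely many `N < N₀`, for which the binomial coefficient is positive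
  obtain ⟨N₀, hN₀⟩ := eventually_atTop.mp ((h1.and h2).and (eventually_gt_atTop 0))
  have hM : (0 : ℝ) < max 1 E := lt_of_lt_of_le one_pos (le_max_left _ _)
  refine ⟨1 / max 1 E ^ N₀, by positivity, fun N => ?_⟩
  have hδ : 1 / max 1 E ^ N₀ ≤ 1 := by
    rw [div_le_one (by positivity)]
    exact one_le_pow₀ (le_max_left _ _)
  by_cases hN : N₀ ≤ N
  · obtain ⟨⟨h3, h4⟩, h5⟩ := hN₀ N hN
    have h6 := Phi_pow_le_choose h5 (hk N)
    have h7 : E' ^ N ≤ Phi (k N / N) ^ N := pow_le_pow_left₀ (hE0.trans hEE').le h3.le N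
    have h8 : E ^ N ≤ N.choose (k N) :=
      le_of_mul_le_mul_left (h4.trans (h7.trans h6)) (by positivity)
    calc 1 / max 1 E ^ N₀ * E ^ N ≤ 1 * E ^ N := by gcongr
      _ ≤ _ := by rwa [one_mul]
  · have h3 : (1 : ℝ) ≤ N.choose (k N) := by exact_mod_cast Nat.choose_pos (hk N)
    refine le_trans ?_ h3
    rw [one_div, inv_mul_le_iff₀ (by positivity), mul_one]
    calc E ^ N ≤ max 1 E ^ N := pow_le_pow_left₀ hE0.le (le_max_right _ _) N
      _ ≤ max 1 E ^ N₀ := pow_le_pow_right₀ (le_max_left _ _) (by omega)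

lemma tendsto_mul_pow_mul_pow_rpow {C E : ℝ} (hC : 0 < C) (hE : 0 ≤ E) (D : ℤ) :
    Tendsto (fun n : ℕ => (C * (n : ℝ) ^ D * E ^ n) ^ (1 / (n : ℝ))) atTop (𝓝 E) := by
  have h1 : Tendsto (fun n : ℕ => C ^ (1 / (n : ℝ))) atTop (𝓝 1) := by
    have h := (Real.continuousAt_const_rpow (b := 0) hC.ne').tendsto.comp
      (tendsto_const_div_atTop_nhds_zero_nat (1 : ℝ))
    rwa [Real.rpow_zero] at h
  have h2 : Tendsto (fun n : ℕ => ((n : ℝ) ^ (1 / (n : ℝ))) ^ D) atTop (𝓝 1) := by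
    have h := (tendsto_rpow_div.comp tendsto_natCast_atTop_atTop).zpow₀ D (Or.inl one_ne_zero)
    rw [one_zpow] at h
    exact h
  have h3 := (h1.mul h2).mul_const E
  rw [one_mul, one_mul] at h3
  refine h3.congr' ?_
  filter_upwards [eventually_gt_atTop 0] with n hn
  have hn' : (0 : ℝ) < n := by exact_mod_cast hn
  rw [Real.mul_rpow (by positivity) (by positivity), Real.mul_rpow hC.le (by positivity),
    one_div, Real.pow_rpow_inv_natCast hE hn.ne', ← Real.rpow_intCast, ← Real.rpow_intCast,
    ← Real.rpow_mul hn'.le, ← Real.rpow_mul hn'.le, mul_comm (D : ℝ)]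

/-- Polynomial factors do not matter for the exponent. -/
lemma HasExponent.of_bounds {c : ℕ → ℕ} {E : ℝ} (hE : 0 < E)
    (hupper : ∃ C > 0, ∃ D : ℕ, ∀ᶠ n : ℕ in atTop, (c n : ℝ) ≤ C * (n : ℝ) ^ D * E ^ n)
    (hlower : ∀ E', 0 < E' → E' < E → ∃ δ > 0, ∀ᶠ n : ℕ in atTop, δ * E' ^ n ≤ n * c n) :
    HasExponent c E := by
  rw [HasExponent, tendsto_order]
  constructor
  · intro a ha
    obtain ⟨E', h1, h2⟩ := exists_between (max_lt ha hE)
    obtain ⟨δ, hδ, h3⟩ := hlower E' ((le_max_right _ _).trans_lt h1) h2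
    have hE' : 0 < E' := (le_max_right _ _).trans_lt h1
    have h4 := tendsto_mul_pow_mul_pow_rpow hδ hE'.le (-1)
    filter_upwards [h4.eventually (lt_mem_nhds ((le_max_left _ _).trans_lt h1)), h3,
      eventually_gt_atTop 0] with n h5 h6 hn
    have hn' : (0 : ℝ) < n := by exact_mod_cast hn
    refine h5.trans_le (Real.rpow_le_rpow (by positivity) ?_ (by positivity))
    rw [zpow_neg_one, mul_assoc, mul_left_comm, inv_mul_le_iff₀ hn']
    exact h6
  · intro a ha
    obtain ⟨C, hC, D, h1⟩ := hupper
    have h4 := tendsto_mul_pow_mul_pow_rpow hC hE.le D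
    filter_upwards [h4.eventually (gt_mem_nhds ha), h1] with n h5 h6
    refine lt_of_le_of_lt (Real.rpow_le_rpow (by positivity) ?_ (by positivity)) h5
    simpa using h6

/-! ### Codimensions as ranks of families of evaluations -/

section Rank

variable {F M : Type*} [Field F] [AddCommGroup M] [Module F M]

/-- If the joint kernel on `V` of finitely many functionals lies in `I`, their number bounds the
codimension of `V ∩ I` in `V`. -/
lemma finrank_quotient_le_card {ρ : Type*} (R : Finset ρ) (V I : Submodule F M)
    (μ : ρ → M →ₗ[F] F) (h : ∀ f ∈ V, (∀ r ∈ R, μ r f = 0) → f ∈ I) :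
    Module.Finite F (V ⧸ I.submoduleOf V) ∧
      Module.finrank F (V ⧸ I.submoduleOf V) ≤ R.card := by
  let L : V →ₗ[F] (R → F) := LinearMap.pi fun r => (μ r).comp V.subtype
  have hker : LinearMap.ker L ≤ I.submoduleOf V := by
    intro f hf
    refine h f f.2 fun r hr => ?_
    exact congrFun (LinearMap.mem_ker.mp hf) ⟨r, hr⟩
  have hsurj := Submodule.factor_surjective hker
  have hfin : Module.Finite F (V ⧸ LinearMap.ker L) :=
    Module.Finite.equiv L.quotKerEquivRange.symm
  refine ⟨Module.Finite.of_surjective _ hsurj, ?_⟩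
  calc Module.finrank F (V ⧸ I.submoduleOf V) ≤ Module.finrank F (V ⧸ LinearMap.ker L) :=
        LinearMap.finrank_le_finrank_of_surjective hsurj
    _ = Module.finrank F (LinearMap.range L) := L.quotKerEquivRange.finrank_eq
    _ ≤ Module.finrank F (R → F) := Submodule.finrank_le _
    _ = R.card := by simp

/-- Elements of `V` with a dual family of functionals that vanish on `I` are linearly independent
modulo `V ∩ I`. -/
lemma card_le_finrank_quotient {ι : Type*} (S : Finset ι) (V I : Submodule F M)
    [Module.Finite F (V ⧸ I.submoduleOf V)] (p : ι → M) (hp : ∀ i ∈ S, p i ∈ V)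
    (l : ι → M →ₗ[F] F) (hl : ∀ i ∈ S, ∀ f ∈ I, l i f = 0)
    (hne : ∀ i ∈ S, l i (p i) ≠ 0) (hoff : ∀ i ∈ S, ∀ j ∈ S, i ≠ j → l i (p j) = 0) :
    S.card ≤ Module.finrank F (V ⧸ I.submoduleOf V) := by
  have hli : LinearIndependent F fun i : S =>
      (I.submoduleOf V).mkQ (⟨p i, hp i i.2⟩ : V) := by
    rw [Fintype.linearIndependent_iff]
    intro g hg i
    have h1 : (∑ j : S, g j • (⟨p j, hp j j.2⟩ : V)) ∈ I.submoduleOf V := by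
      rw [← Submodule.ker_mkQ (I.submoduleOf V), LinearMap.mem_ker, map_sum, ← hg]
      rfl
    have h2 := hl i i.2 _ h1
    rw [map_sum, map_sum, Finset.sum_eq_single i] at h2
    · rw [map_smul, map_smul, smul_eq_mul] at h2
      exact (mul_eq_zero.mp h2).resolve_right (hne i i.2)
    · intro j _ hji
      rw [map_smul, map_smul, smul_eq_mul]
      exact mul_eq_zero_of_right _ (hoff i i.2 j j.2 fun e => hji (Subtype.ext e.symm))
    · exact fun h => absurd (Finset.mem_univ i) h
  simpa using hli.fintype_card_le_finrank

end Rank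

section Identities

variable {F : Type*} [Field F] {X : Type*}

/-- The span of the nonassociative monomials whose letters, with multiplicity, form `m`. -/
def monomialSpan (F : Type*) [Field F] {X : Type*} (m : Multiset X) :
    Submodule F (FreeNonUnitalNonAssocAlgebra F X) :=
  Submodule.span F {f | ∃ t : FreeMagma X, letters t = m ∧ f = MonoidAlgebra.ofMagma F _ t}

lemma multilinear_eq_monomialSpan (s : Finset X) : multilinear F s = monomialSpan F s.val := rfl

lemma of_mem_monomialSpan (x : X) :
    FreeNonUnitalNonAssocAlgebra.of F x ∈ monomialSpan F {x} :=
  Submodule.subset_span ⟨FreeMagma.of x, rfl, rfl⟩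

lemma mul_mem_monomialSpan {m n : Multiset X} {f g : FreeNonUnitalNonAssocAlgebra F X}
    (hf : f ∈ monomialSpan F m) (hg : g ∈ monomialSpan F n) : f * g ∈ monomialSpan F (m + n) := by
  refine Submodule.span_induction (p := fun f _ => f * g ∈ monomialSpan F (m + n))
    ?_ ?_ ?_ ?_ hf
  · rintro _ ⟨t, ht, rfl⟩
    refine Submodule.span_induction
      (p := fun g _ => MonoidAlgebra.ofMagma F _ t * g ∈ monomialSpan F (m + n)) ?_ ?_ ?_ ?_ hg
    · rintro _ ⟨s, hs, rfl⟩
      exact Submodule.subset_span ⟨t * s, by rw [← ht, ← hs]; rfl, (map_mul _ _ _).symm⟩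
    · rw [mul_zero]
      exact zero_mem _
    · intro x y _ _ hx hy
      rw [mul_add]
      exact add_mem hx hy
    · intro c x _ hx
      rw [mul_smul_comm]
      exact Submodule.smul_mem _ _ hx
  · rw [zero_mul]
    exact zero_mem _
  · intro x y _ _ hx hy
    rw [add_mul]
    exact add_mem hx hy
  · intro c x _ hx
    rw [smul_mul_assoc]
    exact Submodule.smul_mem _ _ hx

variable {B : Type*} [NonUnitalNonAssocRing B] [Module F B] [IsScalarTower F B B]
  [SMulCommClass F B B]

@[simp] lemma letters_of (x : X) : letters (FreeMagma.of x) = {x} := rfl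

@[simp] lemma letters_mul (s t : FreeMagma X) : letters (s * t) = letters s + letters t := rfl

lemma lift_ofMagma_of (φ : X → B) (x : X) :
    FreeNonUnitalNonAssocAlgebra.lift F φ (MonoidAlgebra.ofMagma F _ (FreeMagma.of x)) = φ x :=
  FreeNonUnitalNonAssocAlgebra.lift_of_apply F φ x

lemma lift_ofMagma_mul (φ : X → B) (s t : FreeMagma X) :
    FreeNonUnitalNonAssocAlgebra.lift F φ (MonoidAlgebra.ofMagma F _ (s * t)) =
      FreeNonUnitalNonAssocAlgebra.lift F φ (MonoidAlgebra.ofMagma F _ s) *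
        FreeNonUnitalNonAssocAlgebra.lift F φ (MonoidAlgebra.ofMagma F _ t) := by
  rw [map_mul, map_mul]

/-- The value of a multilinear polynomial depends only on the values of its variables. -/
lemma lift_congr_of_mem_multilinear {s : Finset X} {φ ψ : X → B} (h : ∀ x ∈ s, φ x = ψ x)
    {f : FreeNonUnitalNonAssocAlgebra F X} (hf : f ∈ multilinear F s) :
    FreeNonUnitalNonAssocAlgebra.lift F φ f = FreeNonUnitalNonAssocAlgebra.lift F ψ f := by
  refine Submodule.span_induction (p := fun f _ => FreeNonUnitalNonAssocAlgebra.lift F φ f =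
    FreeNonUnitalNonAssocAlgebra.lift F ψ f) ?_ (by rw [map_zero, map_zero])
    (fun x y _ _ hx hy => by rw [map_add, map_add, hx, hy])
    (fun c x _ hx => by rw [map_smul, map_smul, hx]) hf
  rintro _ ⟨t, ht, rfl⟩
  have key : ∀ t : FreeMagma X, (∀ x ∈ letters t, φ x = ψ x) →
      FreeNonUnitalNonAssocAlgebra.lift F φ (MonoidAlgebra.ofMagma F _ t) =
      FreeNonUnitalNonAssocAlgebra.lift F ψ (MonoidAlgebra.ofMagma F _ t) := by
    intro t
    induction t with
    | ih1 x =>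
      intro h
      rw [lift_ofMagma_of, lift_ofMagma_of, h x (by simp)]
    | ih2 a b iha ihb =>
      intro h
      rw [lift_ofMagma_mul, lift_ofMagma_mul, iha fun x hx => h x (by simp [hx]),
        ihb fun x hx => h x (by simp [hx])]
  exact key t fun x hx => h x (by rw [ht] at hx; exact hx)

open Classical in
/-- A multilinear polynomial is linear in each of its variables. -/
lemma exists_lift_update_eq {s : Finset X} {x : X} (hx : x ∈ s) (φ : X → B)
    {f : FreeNonUnitalNonAssocAlgebra F X} (hf : f ∈ multilinear F s) :
    ∃ L : B →ₗ[F] B, ∀ y, FreeNonUnitalNonAssocAlgebra.lift F (Function.update φ x y) f = L y := by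
  refine Submodule.span_induction (p := fun f _ => ∃ L : B →ₗ[F] B, ∀ y,
    FreeNonUnitalNonAssocAlgebra.lift F (Function.update φ x y) f = L y) ?_
    ⟨0, fun y => by rw [map_zero]; rfl⟩ ?_ ?_ hf
  · rintro _ ⟨t, ht, rfl⟩
    have key : ∀ t : FreeMagma X,
        (x ∉ letters t → ∃ c : B, ∀ y, FreeNonUnitalNonAssocAlgebra.lift F (Function.update φ x y)
          (MonoidAlgebra.ofMagma F _ t) = c) ∧
        ((letters t).count x = 1 → ∃ L : B →ₗ[F] B, ∀ y,
          FreeNonUnitalNonAssocAlgebra.lift F (Function.update φ x y)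
          (MonoidAlgebra.ofMagma F _ t) = L y) := by
      intro t
      induction t with
      | ih1 z =>
        refine ⟨fun h => ⟨φ z, fun y => ?_⟩, fun h => ⟨LinearMap.id, fun y => ?_⟩⟩
        · rw [lift_ofMagma_of, Function.update_of_ne]
          rintro rfl
          exact h (by simp)
        · have : x = z := by
            by_contra hne
            rw [letters_of, Multiset.count_singleton, if_neg hne] at h
            omega
          rw [lift_ofMagma_of, this, Function.update_self]
          rfl
      | ih2 a b iha ihb =>
        refine ⟨fun h => ?_, fun h => ?_⟩
        · rw [letters_mul, Multiset.mem_add, not_or] at h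
          obtain ⟨c, hc⟩ := iha.1 h.1
          obtain ⟨d, hd⟩ := ihb.1 h.2
          exact ⟨c * d, fun y => by rw [lift_ofMagma_mul, hc, hd]⟩
        · rw [letters_mul, Multiset.count_add] at h
          by_cases ha : (letters a).count x = 0
          · obtain ⟨c, hc⟩ := iha.1 (Multiset.count_eq_zero.mp ha)
            obtain ⟨L, hL⟩ := ihb.2 (by omega)
            exact ⟨(LinearMap.mulLeft F c).comp L, fun y => by rw [lift_ofMagma_mul, hc, hL]; rfl⟩
          · obtain ⟨L, hL⟩ := iha.2 (by omega)
            obtain ⟨d, hd⟩ := ihb.1 (Multiset.count_eq_zero.mp (by omega))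
            exact ⟨(LinearMap.mulRight F d).comp L, fun y => by
              rw [lift_ofMagma_mul, hd, hL]; rfl⟩
    refine (key t).2 ?_
    rw [ht]
    exact Multiset.count_eq_one_of_mem s.nodup hx
  · rintro f g _ _ ⟨L, hL⟩ ⟨L', hL'⟩
    exact ⟨L + L', fun y => by rw [map_add, hL, hL']; rfl⟩
  · rintro c f _ ⟨L, hL⟩
    exact ⟨c • L, fun y => by rw [map_smul, hL]; rfl⟩

/-- The polynomials that vanish whenever each variable `x` is replaced by an element of `D x`. -/
def identitiesOn (D : X → Submodule F B) : Submodule F (FreeNonUnitalNonAssocAlgebra F X) where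
  carrier := {f | ∀ φ : X → B, (∀ x, φ x ∈ D x) → FreeNonUnitalNonAssocAlgebra.lift F φ f = 0}
  zero_mem' := fun φ _ => map_zero _
  add_mem' := fun {f g} hf hg φ h => by rw [map_add, hf φ h, hg φ h, add_zero]
  smul_mem' := fun c f hf φ h => by rw [map_smul, hf φ h, smul_zero]

/-- A multilinear polynomial need only be evaluated at elements of spanning sets. -/
lemma mem_identitiesOn_of_span {s : Finset X} {f : FreeNonUnitalNonAssocAlgebra F X}
    (hf : f ∈ multilinear F s) (S : X → Set B)
    (h : ∀ φ : X → B, (∀ x ∈ s, φ x ∈ S x) → FreeNonUnitalNonAssocAlgebra.lift F φ f = 0) :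
    f ∈ identitiesOn fun x => Submodule.span F (S x) := by
  classical
  have key : ∀ r ⊆ s, ∀ φ : X → B, (∀ x ∈ r, φ x ∈ Submodule.span F (S x)) →
      (∀ x ∈ s, x ∉ r → φ x ∈ S x) → FreeNonUnitalNonAssocAlgebra.lift F φ f = 0 := by
    intro r
    induction r using Finset.induction_on with
    | empty => exact fun _ φ _ h' => h φ fun x hx => h' x hx (by simp)
    | insert x r hxr ih =>
      intro hrs φ h1 h2
      have hxs : x ∈ s := hrs (Finset.mem_insert_self x r)
      obtain ⟨L, hL⟩ := exists_lift_update_eq hxs φ hf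
      rw [← Function.update_eq_self x φ, hL]
      refine Submodule.span_induction (p := fun y _ => L y = 0) ?_ (map_zero L)
        (fun y z _ _ hy hz => by rw [map_add, hy, hz, add_zero])
        (fun c y _ hy => by rw [map_smul, hy, smul_zero]) (h1 x (Finset.mem_insert_self x r))
      intro y hy
      rw [← hL]
      refine ih (fun z hz => hrs (Finset.mem_insert_of_mem hz)) _ ?_ ?_
      · intro z hz
        rw [Function.update_of_ne (by rintro rfl; exact hxr hz)]
        exact h1 z (Finset.mem_insert_of_mem hz)
      · intro z hz hzr
        by_cases hzx : z = x
        · subst hzx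
          rwa [Function.update_self]
        · rw [Function.update_of_ne hzx]
          exact h2 z hz (by simp [hzx, hzr])
  exact fun φ hφ => key s subset_rfl φ (fun x _ => hφ x) fun x hx hx' => absurd hx hx'

/-- Identities may be tested in a larger algebra. -/
lemma identitiesOn_map {B' : Type*} [NonUnitalNonAssocRing B'] [Module F B'] [IsScalarTower F B' B']
    [SMulCommClass F B' B'] (i : B →ₙₐ[F] B') (hi : Function.Injective i)
    (D : X → Submodule F B) :
    identitiesOn (fun x => (D x).map (i : B →ₗ[F] B')) = identitiesOn D := by
  have key : ∀ φ : X → B, ∀ f, FreeNonUnitalNonAssocAlgebra.lift F (fun x => i (φ x)) f =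
      i (FreeNonUnitalNonAssocAlgebra.lift F φ f) := by
    intro φ f
    have : FreeNonUnitalNonAssocAlgebra.lift F (fun x => i (φ x)) =
        i.comp (FreeNonUnitalNonAssocAlgebra.lift F φ) := by
      refine FreeNonUnitalNonAssocAlgebra.hom_ext F fun x => ?_
      rw [FreeNonUnitalNonAssocAlgebra.lift_of_apply, NonUnitalAlgHom.comp_apply,
        FreeNonUnitalNonAssocAlgebra.lift_of_apply]
    rw [this, NonUnitalAlgHom.comp_apply]
  ext f
  constructor
  · intro hf φ hφ
    refine hi ?_
    rw [← key, map_zero]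
    exact hf _ fun x => ⟨φ x, hφ x, rfl⟩
  · intro hf φ hφ
    choose ψ hψ hψ' using hφ
    obtain rfl : (fun x => i (ψ x)) = φ := funext hψ'
    rw [key, hf ψ hψ, map_zero]

end Identities

/-! ### Monomials in the unital chain algebra -/

/-- The basis of the unital chain algebra: the unit, the generators `a` and `b`, and the elements
`u t` of the chain. -/
inductive Atom : Type
  | one : Atom
  | a : Atom
  | b : Atom
  | u (t : ℕ) : Atom

namespace Atom

/-- The multiplication table of the unital chain algebra with word `c`: the element `u t` is sent
to `u (t + 1)` by `b` if `c t` holds and by `a` otherwise. The value `none` stands for `0`. -/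
def mul (c : ℕ → Bool) : Atom → Atom → Option Atom
  | one, y => some y
  | x, one => some x
  | u t, a => if c t then none else some (u (t + 1))
  | u t, b => if c t then some (u (t + 1)) else none
  | _, _ => none

/-- The contribution of one factor to the numbers of factors `a`, `b` and `u t` of a product, and
to the sum of the indices `t` of the latter. -/
def content : Atom → ℕ × ℕ × ℕ × ℕ
  | one => 0
  | a => (1, 0, 0, 0)
  | b => (0, 1, 0, 0)
  | u t => (0, 0, 1, t)

/-- `IsValue c k y` says that `y` is the only possible nonzero value of a product of basis elements
whose contents add up to `k`. -/
def IsValue (c : ℕ → Bool) (k : ℕ × ℕ × ℕ × ℕ) : Atom → Prop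
  | one => k = 0
  | a => k = (1, 0, 0, 0)
  | b => k = (0, 1, 0, 0)
  | u r => k.2.2.1 = 1 ∧ r = k.2.2.2 + (k.1 + k.2.1) ∧ k.2.1 = trues c k.2.2.2 (k.1 + k.2.1)

variable {c : ℕ → Bool}

lemma isValue_content (x : Atom) : IsValue c x.content x := by
  cases x <;> simp [IsValue, content]

lemma IsValue.unique {k : ℕ × ℕ × ℕ × ℕ} {x y : Atom} (hx : IsValue c k x) (hy : IsValue c k y) :
    x = y := by
  obtain ⟨k1, k2, k3, k4⟩ := k
  cases x <;> cases y <;> simp [IsValue] at hx hy ⊢ <;> omega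

lemma IsValue.mul {k l : ℕ × ℕ × ℕ × ℕ} {x y z : Atom} (hx : IsValue c k x) (hy : IsValue c l y)
    (h : Atom.mul c x y = some z) : IsValue c (k + l) z := by
  cases x with
  | one =>
    obtain rfl : k = 0 := hx
    simp only [Atom.mul, Option.some.injEq] at h
    rwa [zero_add, ← h]
  | a =>
    cases y <;> simp only [Atom.mul, Option.some.injEq, reduceCtorEq] at h
    obtain rfl : l = 0 := hy
    rwa [add_zero, ← h]
  | b =>
    cases y <;> simp only [Atom.mul, Option.some.injEq, reduceCtorEq] at h
    obtain rfl : l = 0 := hy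
    rwa [add_zero, ← h]
  | u t =>
    cases y with
    | one =>
      simp only [Atom.mul, Option.some.injEq] at h
      obtain rfl : l = 0 := hy
      rwa [add_zero, ← h]
    | a =>
      obtain rfl : l = (1, 0, 0, 0) := hy
      obtain ⟨k1, k2, k3, k4⟩ := k
      obtain ⟨h1, h2, h3⟩ := hx
      dsimp only at h1 h2 h3
      simp only [Atom.mul] at h
      split_ifs at h with hc
      rw [Option.some.injEq] at h
      subst h
      rw [h2] at hc
      refine ⟨by simp [h1], by simp; omega, ?_⟩
      simp only [Prod.mk_add_mk, add_zero]
      rw [show k1 + 1 + k2 = k1 + k2 + 1 by omega, trues_succ, if_neg hc, add_zero]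
      exact h3
    | b =>
      obtain rfl : l = (0, 1, 0, 0) := hy
      obtain ⟨k1, k2, k3, k4⟩ := k
      obtain ⟨h1, h2, h3⟩ := hx
      dsimp only at h1 h2 h3
      simp only [Atom.mul] at h
      split_ifs at h with hc
      rw [Option.some.injEq] at h
      subst h
      rw [h2] at hc
      refine ⟨by simp [h1], by simp; omega, ?_⟩
      simp only [Prod.mk_add_mk, add_zero]
      rw [← add_assoc, trues_succ, if_pos hc, ← h3]
    | u s => simp [Atom.mul] at h

end Atom

section Value

variable {X : Type*} (c : ℕ → Bool)

/-- The value of a monomial under a substitution of basis elements, `none` standing for `0`. -/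
def value (g : X → Atom) : FreeMagma X → Option Atom
  | .of x => some (g x)
  | .mul s t => (value g s).bind fun x => (value g t).bind fun y => Atom.mul c x y

variable {c}

@[simp] lemma value_of (g : X → Atom) (x : X) : value c g (FreeMagma.of x) = some (g x) := rfl

@[simp] lemma value_mul (g : X → Atom) (s t : FreeMagma X) : value c g (s * t) =
    (value c g s).bind fun x => (value c g t).bind fun y => Atom.mul c x y := rfl

lemma isValue_of_value_eq_some (g : X → Atom) (t : FreeMagma X) {y : Atom}
    (h : value c g t = some y) :
    Atom.IsValue c ((letters t).map fun x => (g x).content).sum y := by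
  induction t generalizing y with
  | ih1 x =>
    simp only [value_of, Option.some.injEq] at h
    subst h
    simpa using Atom.isValue_content (g x)
  | ih2 s t ihs iht =>
    simp only [value_mul, Option.bind_eq_some_iff] at h
    obtain ⟨x, hx, z, hz, h⟩ := h
    rw [letters_mul, Multiset.map_add, Multiset.sum_add]
    exact (ihs hx).mul (iht hz) h

/-- Two values of a monomial with `n` factors `a` or `b` that agree up to a translation of the chain
taking `u t` to `u t'`. -/
def SameValue (t t' n : ℕ) (x y : Option Atom) : Prop :=
  (x = none ∧ y = none) ∨ (n = 0 ∧ x = some .one ∧ y = some .one) ∨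
  (n = 1 ∧ x = some .a ∧ y = some .a) ∨ (n = 1 ∧ x = some .b ∧ y = some .b) ∨
  (x = some (.u (t + n)) ∧ y = some (.u (t' + n)))

lemma SameValue.mul {t t' n n' j : ℕ} {x y x' y' : Option Atom} (h : SameValue t t' n x y)
    (h' : SameValue t t' n' x' y') (hn : n + n' ≤ j) (hc : ∀ l < j, c (t + l) = c (t' + l)) :
    SameValue t t' (n + n') (x.bind fun p => x'.bind fun q => Atom.mul c p q)
      (y.bind fun p => y'.bind fun q => Atom.mul c p q) := by
  rcases h with ⟨rfl, rfl⟩ | ⟨rfl, rfl, rfl⟩ | ⟨rfl, rfl, rfl⟩ | ⟨rfl, rfl, rfl⟩ | ⟨rfl, rfl⟩ <;>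
  rcases h' with ⟨rfl, rfl⟩ | ⟨rfl, rfl, rfl⟩ | ⟨rfl, rfl, rfl⟩ | ⟨rfl, rfl, rfl⟩ | ⟨rfl, rfl⟩ <;>
  first
  | (simp [SameValue, Atom.mul]; done)
  | (have e := hc n (by omega)
     cases e1 : c (t + n) <;> rw [e1] at e <;>
       simp [SameValue, Atom.mul, e1, ← e, add_assoc])

/-- A monomial with one factor from the chain only sees the subword of `c` read off by the
factors `a` and `b`. -/
lemma sameValue_value {g g' : X → Atom} {x₀ : X} {t t' j : ℕ} (h0 : g x₀ = .u t)
    (h0' : g' x₀ = .u t') (heq : ∀ x, x ≠ x₀ → g x = g' x ∧ ∀ r, g x ≠ .u r)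
    (hc : ∀ l < j, c (t + l) = c (t' + l)) (τ : FreeMagma X)
    (hj : ((letters τ).map fun x => (g x).content.1 + (g x).content.2.1).sum ≤ j) :
    SameValue t t' ((letters τ).map fun x => (g x).content.1 + (g x).content.2.1).sum
      (value c g τ) (value c g' τ) := by
  induction τ with
  | ih1 x =>
    by_cases hx : x = x₀
    · subst hx
      simp [h0, h0', SameValue, Atom.content]
    · obtain ⟨h1, h2⟩ := heq x hx
      cases hg : g x with
      | u r => exact absurd hg (h2 r)
      | _ => simp [← h1, hg, SameValue, Atom.content]
  | ih2 σ τ ihs iht =>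
    rw [letters_mul, Multiset.map_add, Multiset.sum_add] at hj ⊢
    exact (ihs (by omega)).mul (iht (by omega)) hj hc

end Value

section Eval

variable {F : Type*} [Field F] {X : Type*}
variable {B : Type*} [NonUnitalNonAssocRing B] [Module F B] [IsScalarTower F B B]
  [SMulCommClass F B B]

/-- The family `bas` in `B` multiplies as the basis of the unital chain algebra with word `c`, and
its members are nonzero, as witnessed by linear functionals. Linear independence is not needed:
each polynomial is evaluated in the span of one member at a time. -/
structure IsChain (F : Type*) [Field F] {B : Type*} [NonUnitalNonAssocRing B] [Module F B]
    (c : ℕ → Bool) (bas : Atom → B) : Prop where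
  mul_eq : ∀ x y, bas x * bas y = (Atom.mul c x y).elim 0 bas
  exists_coord : ∀ x, ∃ l : B →ₗ[F] F, l (bas x) = 1

variable {c : ℕ → Bool} {bas : Atom → B}

lemma IsChain.lift_ofMagma (hB : IsChain F c bas) (g : X → Atom) (t : FreeMagma X) :
    FreeNonUnitalNonAssocAlgebra.lift F (fun x => bas (g x)) (MonoidAlgebra.ofMagma F _ t) =
      (value c g t).elim 0 bas := by
  induction t with
  | ih1 x => rw [lift_ofMagma_of]; rfl
  | ih2 s t ihs iht =>
    rw [lift_ofMagma_mul, ihs, iht, value_mul]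
    cases value c g s <;> cases value c g t <;> simp [hB.mul_eq]

/-- If the values of the multilinear monomials under two substitutions vanish simultaneously and
are otherwise equal to `bas y` and `bas y'`, then the values of multilinear polynomials are
proportional to these with the same coefficient. -/
lemma IsChain.exists_lift_eq_smul (hB : IsChain F c bas) {s : Finset X} {g g' : X → Atom}
    {y y' : Atom} (h : ∀ t, letters t = s.val →
      (value c g t = none ∧ value c g' t = none) ∨ (value c g t = some y ∧ value c g' t = some y'))
    {f : FreeNonUnitalNonAssocAlgebra F X} (hf : f ∈ multilinear F s) :
    ∃ κ : F, FreeNonUnitalNonAssocAlgebra.lift F (fun x => bas (g x)) f = κ • bas y ∧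
      FreeNonUnitalNonAssocAlgebra.lift F (fun x => bas (g' x)) f = κ • bas y' := by
  refine Submodule.span_induction (p := fun f _ => ∃ κ : F,
    FreeNonUnitalNonAssocAlgebra.lift F (fun x => bas (g x)) f = κ • bas y ∧
      FreeNonUnitalNonAssocAlgebra.lift F (fun x => bas (g' x)) f = κ • bas y') ?_ ?_ ?_ ?_ hf
  · rintro _ ⟨t, ht, rfl⟩
    rw [hB.lift_ofMagma, hB.lift_ofMagma]
    rcases h t ht with ⟨h1, h2⟩ | ⟨h1, h2⟩ <;> rw [h1, h2]
    · exact ⟨0, by simp, by simp⟩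
    · exact ⟨1, by simp, by simp⟩
  · exact ⟨0, by simp, by simp⟩
  · rintro f₁ f₂ _ _ ⟨κ, h1, h2⟩ ⟨κ', h1', h2'⟩
    exact ⟨κ + κ', by rw [map_add, h1, h1', add_smul], by rw [map_add, h2, h2', add_smul]⟩
  · rintro r f₁ _ ⟨κ, h1, h2⟩
    exact ⟨r * κ, by rw [map_smul, h1, mul_smul], by rw [map_smul, h2, mul_smul]⟩

end Eval

/-! ### Substitutions up to equivalence -/

section Pattern

open Classical in
/-- The substitution which sends the variable `i₀` to `y`, those in `S` to `b`, the others in `U`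
to `a`, and all remaining ones to the unit. -/
def pattern {n : ℕ} (i₀ : Fin n) (U S : Finset (Fin n)) (y : Atom) : Fin n → Atom := fun i =>
  if i = i₀ then y else if i ∈ S then .b else if i ∈ U then .a else .one

/-- A position of degree `d` in the chain at which the word `W` is read, if there is one. -/
def start (c : ℕ → Bool) (deg : Atom → ZMod 2) (W : List Bool) (d : ZMod 2) : ℕ := by
  classical
  exact if h : ∃ t, word c t W.length = W ∧ deg (.u t) = d then h.choose else 0

lemma start_spec {c : ℕ → Bool} {deg : Atom → ZMod 2} (t n : ℕ) :
    word c (start c deg (word c t n) (deg (.u t))) n = word c t n ∧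
      deg (.u (start c deg (word c t n) (deg (.u t)))) = deg (.u t) := by
  have h : ∃ t', word c t' (word c t n).length = word c t n ∧ deg (.u t') = deg (.u t) :=
    ⟨t, by rw [length_word], rfl⟩
  rw [start, dif_pos h]
  exact ⟨(congrArg (word c _) (length_word c t n).symm).trans h.choose_spec.1, h.choose_spec.2⟩

open Classical in
/-- Representatives of the substitutions of basis elements under which some multilinear monomial
may be nonzero. The family `𝒰` restricts, for each position of the element of the chain, the set
of the other variables that are not replaced by the unit. -/
def patterns (c : ℕ → Bool) (deg : Atom → ZMod 2) {n : ℕ} (𝒰 : Fin n → Finset (Finset (Fin n))) :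
    Finset (Fin n → Atom) :=
  (Finset.univ.biUnion fun i => {pattern i ∅ ∅ .one, pattern i ∅ ∅ .a, pattern i ∅ ∅ .b}) ∪
  Finset.univ.biUnion fun i => (𝒰 i).biUnion fun U => (subwords c U.card).biUnion fun W =>
    (Finset.powersetCard (W.count true) U).biUnion fun S =>
      Finset.univ.image fun d : ZMod 2 => pattern i U S (.u (start c deg W d))

lemma card_patterns_le (c : ℕ → Bool) (deg : Atom → ZMod 2) {n : ℕ}
    (𝒰 : Fin n → Finset (Finset (Fin n))) :
    (patterns c deg 𝒰).card ≤ 3 * n +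
      ∑ i, ∑ U ∈ 𝒰 i, ∑ W ∈ subwords c U.card, 2 * U.card.choose (W.count true) := by
  classical
  refine (Finset.card_union_le _ _).trans (Nat.add_le_add ?_ ?_)
  · refine Finset.card_biUnion_le.trans ?_
    calc _ ≤ ∑ i : Fin n, 3 := Finset.sum_le_sum fun i _ => Finset.card_le_three
      _ = 3 * n := by simp [mul_comm]
  · refine Finset.card_biUnion_le.trans (Finset.sum_le_sum fun i _ => ?_)
    refine Finset.card_biUnion_le.trans (Finset.sum_le_sum fun U _ => ?_)
    refine Finset.card_biUnion_le.trans (Finset.sum_le_sum fun W _ => ?_)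
    refine Finset.card_biUnion_le.trans ?_
    calc _ ≤ ∑ S ∈ Finset.powersetCard (W.count true) U, 2 := Finset.sum_le_sum fun S _ =>
          Finset.card_image_le.trans (by simp [ZMod.card])
      _ = _ := by simp [mul_comm]

lemma sum_content_pattern {n : ℕ} {i₀ : Fin n} {U S : Finset (Fin n)} (hU : i₀ ∉ U) (hS : S ⊆ U)
    (t : ℕ) : ∑ i, (pattern i₀ U S (.u t) i).content = (U.card - S.card, S.card, 1, t) := by
  classical
  have key : ∀ i, (pattern i₀ U S (.u t) i).content =
      (if i ∈ U \ S then 1 else 0, if i ∈ S then 1 else 0, if i = i₀ then 1 else 0,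
        if i = i₀ then t else 0) := by
    intro i
    by_cases h0 : i = i₀
    · subst h0
      have : i ∉ S := fun h => hU (hS h)
      simp [pattern, Atom.content, hU, this]
    · by_cases h1 : i ∈ S
      · simp [pattern, Atom.content, h0, h1]
      · by_cases h2 : i ∈ U
        · simp [pattern, Atom.content, h0, h1, h2]
        · simp only [pattern, Atom.content, h0, h1, h2, Finset.mem_sdiff, if_false, false_and]
          rfl
  simp only [key]
  ext
  · rw [Prod.fst_sum, Finset.sum_boole, Finset.filter_univ_mem, Finset.card_sdiff_of_subset hS]
    rfl
  all_goals simp [Prod.fst_sum, Prod.snd_sum]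

end Pattern

/-! ### The upper bound for the codimension -/

section Upper

variable {F : Type*} [Field F] {X : Type*}
variable {B : Type*} [NonUnitalNonAssocRing B] [Module F B] [IsScalarTower F B B]
  [SMulCommClass F B B] {c : ℕ → Bool} {bas : Atom → B}

/-- The substitution extending `h` along `e`, with the unit for all other variables. -/
def extendAtom {n : ℕ} (e : Fin n ↪ X) (h : Fin n → Atom) : X → Atom :=
  Function.extend e h fun _ => .one

lemma extendAtom_apply {n : ℕ} (e : Fin n ↪ X) (h : Fin n → Atom) (i : Fin n) :
    extendAtom e h (e i) = h i := e.injective.extend_apply _ _ _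

lemma sum_map_letters {n : ℕ} {e : Fin n ↪ X} {M : Type*} [AddCommMonoid M] (φ : Atom → M)
    (h : Fin n → Atom) {t : FreeMagma X} (ht : letters t = (Finset.univ.map e).val) :
    ((letters t).map fun x => φ (extendAtom e h x)).sum = ∑ i, φ (h i) := by
  rw [ht, Finset.map_val, Multiset.map_map]
  exact congrArg Multiset.sum (Multiset.map_congr rfl fun i _ => by
    rw [Function.comp_apply, extendAtom_apply])

/-- The only possible nonzero value of a multilinear monomial under the substitution `h`. -/
def target (c : ℕ → Bool) {n : ℕ} (h : Fin n → Atom) : Atom := by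
  classical
  exact if H : ∃ y, Atom.IsValue c (∑ i, (h i).content) y then H.choose else .one

lemma target_eq {n : ℕ} {h : Fin n → Atom} {y : Atom}
    (hy : Atom.IsValue c (∑ i, (h i).content) y) : target c h = y := by
  have H : ∃ y, Atom.IsValue c (∑ i, (h i).content) y := ⟨y, hy⟩
  rw [target, dif_pos H]
  exact H.choose_spec.unique hy

lemma isValue_of_multilinear {n : ℕ} {e : Fin n ↪ X} {h : Fin n → Atom} {t : FreeMagma X}
    (ht : letters t = (Finset.univ.map e).val) {y : Atom}
    (hy : value c (extendAtom e h) t = some y) : Atom.IsValue c (∑ i, (h i).content) y := by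
  have := isValue_of_value_eq_some (extendAtom e h) t hy
  rwa [sum_map_letters Atom.content h ht] at this

/-- The evaluation at `h`, read off at the only possible nonzero value of a monomial. -/
def evalCoord (hB : IsChain F c bas) {n : ℕ} (e : Fin n ↪ X) (h : Fin n → Atom) :
    FreeNonUnitalNonAssocAlgebra F X →ₗ[F] F :=
  (hB.exists_coord (target c h)).choose.comp
    ((FreeNonUnitalNonAssocAlgebra.lift F fun x => bas (extendAtom e h x) :
      FreeNonUnitalNonAssocAlgebra F X →ₙₐ[F] B) : FreeNonUnitalNonAssocAlgebra F X →ₗ[F] B)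

lemma evalCoord_of_lift_eq (hB : IsChain F c bas) {n : ℕ} (e : Fin n ↪ X) {h : Fin n → Atom}
    {y : Atom} (hy : Atom.IsValue c (∑ i, (h i).content) y) {κ : F}
    {f : FreeNonUnitalNonAssocAlgebra F X}
    (hf : FreeNonUnitalNonAssocAlgebra.lift F (fun x => bas (extendAtom e h x)) f = κ • bas y) :
    evalCoord hB e h f = κ := by
  have e1 : evalCoord hB e h f = (hB.exists_coord (target c h)).choose
    (FreeNonUnitalNonAssocAlgebra.lift F (fun x => bas (extendAtom e h x)) f) := rfl
  have e2 := (hB.exists_coord (target c h)).choose_spec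
  rw [e1, hf, map_smul]
  rw [target_eq hy] at e2 ⊢
  rw [e2, smul_eq_mul, mul_one]

lemma IsChain.lift_eq_zero (hB : IsChain F c bas) {s : Finset X} {g : X → Atom}
    (h : ∀ t, letters t = s.val → value c g t = none) {f : FreeNonUnitalNonAssocAlgebra F X}
    (hf : f ∈ multilinear F s) :
    FreeNonUnitalNonAssocAlgebra.lift F (fun x => bas (g x)) f = 0 := by
  refine Submodule.span_induction (p := fun f _ =>
    FreeNonUnitalNonAssocAlgebra.lift F (fun x => bas (g x)) f = 0) ?_ (map_zero _)
    (fun x y _ _ hx hy => by rw [map_add, hx, hy, add_zero])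
    (fun r x _ hx => by rw [map_smul, hx, smul_zero]) hf
  rintro _ ⟨t, ht, rfl⟩
  rw [hB.lift_ofMagma, h t ht]
  rfl

/-- A substitution with one element of the chain is a `pattern`. -/
lemma exists_eq_pattern {n : ℕ} {h : Fin n → Atom}
    (h1 : (∑ i, (h i).content).2.2.1 = 1) :
    ∃ i₀ U S t, h = pattern i₀ U S (.u t) ∧ i₀ ∉ U ∧ S ⊆ U ∧
      ∀ i, i ∈ U ↔ i ≠ i₀ ∧ h i ≠ .one := by
  classical
  have hsum : ∑ i, (h i).content.2.2.1 = 1 := by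
    rw [← h1, Prod.snd_sum, Prod.snd_sum, Prod.fst_sum]
  obtain ⟨i₀, -, hi₀⟩ := Finset.exists_ne_zero_of_sum_ne_zero
    (s := Finset.univ) (f := fun i => (h i).content.2.2.1) (by rw [hsum]; exact one_ne_zero)
  obtain ⟨t, ht⟩ : ∃ t, h i₀ = .u t := by
    cases hh : h i₀ with
    | u t => exact ⟨t, rfl⟩
    | _ => simp [hh, Atom.content] at hi₀
  have hother : ∀ i, i ≠ i₀ → ∀ r, h i ≠ .u r := by
    intro i hi r hr
    have h2 : ∑ j ∈ {i, i₀}, (h j).content.2.2.1 ≤ ∑ j, (h j).content.2.2.1 :=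
      Finset.sum_le_sum_of_subset (Finset.subset_univ _)
    rw [Finset.sum_pair hi, hsum, hr, ht] at h2
    simp [Atom.content] at h2
  refine ⟨i₀, (Finset.univ.erase i₀).filter fun i => h i ≠ .one,
    (Finset.univ.erase i₀).filter fun i => h i = .b, t, ?_, by simp, ?_, by simp⟩
  · funext i
    by_cases hi : i = i₀
    · subst hi
      simp [pattern, ht]
    · cases hh : h i with
      | u r => exact absurd hh (hother i hi r)
      | _ => simp [pattern, hi, hh]
  · intro i hi
    rw [Finset.mem_filter] at hi ⊢
    exact ⟨hi.1, by rw [hi.2]; simp⟩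

lemma exists_eq_pattern_empty {n : ℕ} {h : Fin n → Atom} {y : Atom} (hy : ∀ r, y ≠ .u r)
    (hv : Atom.IsValue c (∑ i, (h i).content) y) (i₁ : Fin n) :
    ∃ i, ∃ y' : Atom, h = pattern i ∅ ∅ y' ∧ ∀ r, y' ≠ .u r := by
  classical
  -- the content of `y` bounds the number of factors different from the unit by one
  have hle : ∑ i, ((h i).content.1 + (h i).content.2.1 + (h i).content.2.2.1) ≤ 1 := by
    have e : ∑ i, ((h i).content.1 + (h i).content.2.1 + (h i).content.2.2.1) =
        (∑ i, (h i).content).1 + (∑ i, (h i).content).2.1 + (∑ i, (h i).content).2.2.1 := by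
      simp only [Finset.sum_add_distrib, Prod.fst_sum, Prod.snd_sum]
    rw [e]
    cases y with
    | u r => exact absurd rfl (hy r)
    | _ =>
      simp only [Atom.IsValue] at hv
      rw [hv]
      simp
  have hu : (∑ i, (h i).content).2.2.1 = 0 := by
    cases y with
    | u r => exact absurd rfl (hy r)
    | _ =>
      simp only [Atom.IsValue] at hv
      rw [hv]
      try rfl
  have hnu : ∀ i r, h i ≠ .u r := by
    intro i r hr
    rw [Prod.snd_sum, Prod.snd_sum, Prod.fst_sum, Finset.sum_eq_zero_iff] at hu
    have := hu i (Finset.mem_univ i)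
    rw [hr] at this
    simp [Atom.content] at this
  by_cases hone : ∀ i, h i = .one
  · refine ⟨i₁, .one, funext fun i => ?_, by simp⟩
    simp [pattern, hone i]
  · push Not at hone
    obtain ⟨i, hi⟩ := hone
    refine ⟨i, h i, funext fun j => ?_, hnu i⟩
    by_cases hj : j = i
    · subst hj
      simp [pattern]
    · simp only [pattern, hj, if_false, Finset.notMem_empty]
      by_contra hj1
      have h2 : ∑ l ∈ {j, i}, ((h l).content.1 + (h l).content.2.1 + (h l).content.2.2.1) ≤
          ∑ l, ((h l).content.1 + (h l).content.2.1 + (h l).content.2.2.1) :=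
        Finset.sum_le_sum_of_subset (Finset.subset_univ _)
      rw [Finset.sum_pair hj] at h2
      have hpos : ∀ x : Atom, x ≠ .one → 1 ≤ x.content.1 + x.content.2.1 + x.content.2.2.1 := by
        intro x hx
        cases x with
        | one => exact absurd rfl hx
        | _ => simp [Atom.content]
      have := hpos _ hi
      have := hpos _ hj1
      omega

/-- The codimension is bounded by the number of admissible patterns: two substitutions with the
same variables replaced by `a`, `b` and the unit impose the same condition when their elements of
the chain are followed by the same subword of `c`. -/
theorem IsChain.finrank_le (hB : IsChain F c bas) (deg : Atom → ZMod 2) {n : ℕ} (hn : 0 < n)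
    (e : Fin n ↪ X) (T : X → Set Atom)
    (hT : ∀ x t t', Atom.u t ∈ T x → deg (.u t') = deg (.u t) → Atom.u t' ∈ T x)
    (𝒰 : Fin n → Finset (Finset (Fin n)))
    (h𝒰 : ∀ h : Fin n → Atom, (∀ i, h i ∈ T (e i)) → ∀ i₀, ∀ U : Finset (Fin n),
      (∀ i, i ∈ U ↔ i ≠ i₀ ∧ h i ≠ .one) → U ∈ 𝒰 i₀)
    (R : Finset (Fin n → Atom))
    (hR : ∀ h ∈ patterns c deg 𝒰, (∀ i, h i ∈ T (e i)) → h ∈ R) :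
    Module.Finite F (multilinear F (Finset.univ.map e) ⧸
        (identitiesOn fun x => Submodule.span F (bas '' T x)).submoduleOf
          (multilinear F (Finset.univ.map e))) ∧
      Module.finrank F (multilinear F (Finset.univ.map e) ⧸
        (identitiesOn fun x => Submodule.span F (bas '' T x)).submoduleOf
          (multilinear F (Finset.univ.map e))) ≤ R.card := by
  classical
  refine finrank_quotient_le_card R _ _ (evalCoord hB e) fun f hf hzero => ?_
  refine mem_identitiesOn_of_span hf _ fun φ hφ => ?_
  have hch : ∀ i, ∃ y ∈ T (e i), bas y = φ (e i) := fun i =>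
    hφ (e i) (Finset.mem_map_of_mem e (Finset.mem_univ i))
  choose h hhT hhφ using hch
  rw [lift_congr_of_mem_multilinear (ψ := fun x => bas (extendAtom e h x)) ?_ hf]
  swap
  · intro x hx
    obtain ⟨i, -, rfl⟩ := Finset.mem_map.mp hx
    rw [extendAtom_apply, hhφ]
  by_cases hy : ∃ y, Atom.IsValue c (∑ i, (h i).content) y
  swap
  · refine hB.lift_eq_zero (fun t ht => ?_) hf
    cases hv : value c (extendAtom e h) t with
    | none => rfl
    | some y => exact absurd ⟨y, isValue_of_multilinear ht hv⟩ hy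
  obtain ⟨y, hy⟩ := hy
  have hval : ∀ t, letters t = (Finset.univ.map e).val → ∀ z,
      value c (extendAtom e h) t = some z → z = y :=
    fun t ht z hz => (isValue_of_multilinear ht hz).unique hy
  by_cases hyu : ∃ r, y = .u r
  · obtain ⟨r, rfl⟩ := hyu
    obtain ⟨i₀, U, S, t, rfl, hi₀, hSU, hU⟩ := exists_eq_pattern hy.1
    have hcard := Finset.card_le_card hSU
    have hsum := sum_content_pattern hi₀ hSU
    obtain ⟨-, hr, htr⟩ := hy
    rw [hsum] at hr htr
    dsimp only at hr htr
    rw [Nat.sub_add_cancel hcard] at hr htr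
    subst hr
    obtain ⟨hs1, hs2⟩ := start_spec (c := c) (deg := deg) t U.card
    set t' := start c deg (word c t U.card) (deg (.u t)) with ht'
    -- move the element of the chain to the chosen position of the same degree and subword
    have hcc : ∀ l < U.card, c (t' + l) = c (t + l) := word_eq_word_iff.mp hs1
    have htr' : S.card = trues c t' U.card := by rw [htr, trues, trues, hs1]
    have hy' : Atom.IsValue c (∑ i, (pattern i₀ U S (.u t') i).content) (.u (t' + U.card)) := by
      rw [hsum]
      exact ⟨rfl, by simp only [Nat.sub_add_cancel hcard],
        by simp only [Nat.sub_add_cancel hcard]; exact htr'⟩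
    have hadm : ∀ i, pattern i₀ U S (.u t') i ∈ T (e i) := by
      intro i
      have h1 := hhT i
      by_cases hi : i = i₀
      · subst hi
        simp only [pattern, if_true] at h1 ⊢
        exact hT _ _ _ h1 hs2
      · simpa only [pattern, hi, if_false] using h1
    have hmem : pattern i₀ U S (.u t') ∈ patterns c deg 𝒰 := by
      refine Finset.mem_union_right _ ?_
      simp only [Finset.mem_biUnion, Finset.mem_univ, true_and, Finset.mem_image]
      refine ⟨i₀, U, h𝒰 _ hhT i₀ U hU, word c t U.card, mem_subwords.mpr ⟨t, rfl⟩, S,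
        Finset.mem_powersetCard.mpr ⟨hSU, htr⟩, deg (.u t), rfl⟩
    have hsame : ∀ τ, letters τ = (Finset.univ.map e).val →
        SameValue t t' U.card (value c (extendAtom e (pattern i₀ U S (.u t))) τ)
          (value c (extendAtom e (pattern i₀ U S (.u t'))) τ) := by
      intro τ hτ
      have hj : ((letters τ).map fun x =>
          (extendAtom e (pattern i₀ U S (.u t)) x).content.1 +
          (extendAtom e (pattern i₀ U S (.u t)) x).content.2.1).sum = U.card := by
        rw [sum_map_letters (fun x : Atom => x.content.1 + x.content.2.1) _ hτ,
          Finset.sum_add_distrib]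
        have e1 := congrArg Prod.fst (hsum t)
        have e2 := congrArg (fun p => p.2.1) (hsum t)
        simp only [Prod.fst_sum, Prod.snd_sum] at e1 e2
        rw [e1, e2, Nat.sub_add_cancel hcard]
      have := sameValue_value (c := c) (g := extendAtom e (pattern i₀ U S (.u t)))
        (g' := extendAtom e (pattern i₀ U S (.u t'))) (x₀ := e i₀) (t := t) (t' := t')
        (j := U.card) (by rw [extendAtom_apply]; simp [pattern])
        (by rw [extendAtom_apply]; simp [pattern]) ?_ (fun l hl => (hcc l hl).symm) τ hj.le
      · rwa [hj] at this
      · intro x hx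
        by_cases hxe : ∃ i, e i = x
        · obtain ⟨i, rfl⟩ := hxe
          have hi : i ≠ i₀ := fun h => hx (by rw [h])
          rw [extendAtom_apply, extendAtom_apply]
          simp only [pattern, hi, if_false, true_and]
          intro r
          split_ifs <;> simp
        · simp [extendAtom, Function.extend_apply' _ _ _ hxe]
    obtain ⟨κ, hκ, hκ'⟩ : ∃ κ : F, FreeNonUnitalNonAssocAlgebra.lift F
        (fun x => bas (extendAtom e (pattern i₀ U S (.u t)) x)) f = κ • bas (.u (t + U.card)) ∧
        FreeNonUnitalNonAssocAlgebra.lift F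
        (fun x => bas (extendAtom e (pattern i₀ U S (.u t')) x)) f =
          κ • bas (.u (t' + U.card)) := by
      refine hB.exists_lift_eq_smul (fun τ hτ => ?_) hf
      have hv := hval τ hτ
      rcases hsame τ hτ with ⟨h1, h2⟩ | ⟨-, h1, h2⟩ | ⟨-, h1, h2⟩ | ⟨-, h1, h2⟩ | ⟨h1, h2⟩
      · exact Or.inl ⟨h1, h2⟩
      · exact absurd (hv _ h1) (by simp)
      · exact absurd (hv _ h1) (by simp)
      · exact absurd (hv _ h1) (by simp)
      · exact Or.inr ⟨h1, h2⟩
    have h0 := hzero _ (hR _ hmem hadm)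
    rw [evalCoord_of_lift_eq hB e hy' hκ'] at h0
    rw [hκ, h0, zero_smul]
  · -- without an element of the chain at most one variable is not the unit
    push Not at hyu
    obtain ⟨i, y', rfl, hy'⟩ := exists_eq_pattern_empty hyu hy ⟨0, hn⟩
    have hmem : pattern i ∅ ∅ y' ∈ patterns c deg 𝒰 := by
      refine Finset.mem_union_left _ ?_
      simp only [Finset.mem_biUnion, Finset.mem_univ, true_and]
      refine ⟨i, ?_⟩
      cases y' with
      | u r => exact absurd rfl (hy' r)
      | _ => simp
    obtain ⟨κ, hκ, -⟩ : ∃ κ : F, FreeNonUnitalNonAssocAlgebra.lift F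
        (fun x => bas (extendAtom e (pattern i ∅ ∅ y') x)) f = κ • bas y ∧
        FreeNonUnitalNonAssocAlgebra.lift F
        (fun x => bas (extendAtom e (pattern i ∅ ∅ y') x)) f = κ • bas y := by
      refine hB.exists_lift_eq_smul (fun τ hτ => ?_) hf
      cases hv : value c (extendAtom e (pattern i ∅ ∅ y')) τ with
      | none => exact Or.inl ⟨rfl, rfl⟩
      | some z => exact Or.inr ⟨by rw [hval τ hτ z hv], by rw [hval τ hτ z hv]⟩
    have h0 := hzero _ (hR _ hmem hhT)
    rw [evalCoord_of_lift_eq hB e hy hκ] at h0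
    rw [hκ, h0, zero_smul]

end Upper

/-! ### Linearly independent left-normed commutators -/

lemma word_succ' (c : ℕ → Bool) (t n : ℕ) : word c t (n + 1) = c t :: word c (t + 1) n := by
  simp only [word, List.range_succ_eq_map, List.map_cons, List.map_map, add_zero]
  exact congrArg _ (List.map_congr_left fun l _ => congrArg c (by
    simp only [Nat.succ_eq_add_one]
    omega))

lemma trues_succ' (c : ℕ → Bool) (t n : ℕ) :
    trues c t (n + 1) = trues c (t + 1) n + if c t then 1 else 0 := by
  rw [trues, word_succ', List.count_cons, trues]
  simp

/-- A set `U` can be ordered in such a way that membership in `S ⊆ U` reads as a given subword,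
provided that `S` has the right cardinality. -/
lemma exists_list_map_eq_word {β : Type*} [DecidableEq β] (c : ℕ → Bool) (r : ℕ)
    (U S : Finset β) (hS : S ⊆ U) (hcard : S.card = trues c r U.card) :
    ∃ L : List β, L.Nodup ∧ (∀ x, x ∈ L ↔ x ∈ U) ∧
      L.map (fun x => decide (x ∈ S)) = word c r U.card := by
  induction hn : U.card generalizing r U S with
  | zero =>
    rw [Finset.card_eq_zero] at hn
    subst hn
    exact ⟨[], List.nodup_nil, by simp, rfl⟩
  | succ n ih =>
    rw [hn, trues_succ'] at hcard
    obtain ⟨x, hxU, hx⟩ : ∃ x ∈ U, decide (x ∈ S) = c r := by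
      by_cases hc : c r
      · rw [if_pos hc] at hcard
        obtain ⟨x, hx⟩ := Finset.card_pos.mp (show 0 < S.card by omega)
        exact ⟨x, hS hx, by simp [hx, hc]⟩
      · rw [if_neg hc] at hcard
        have h1 := trues_le c (r + 1) n
        obtain ⟨x, hx, hx'⟩ := Finset.exists_mem_notMem_of_card_lt_card
          (show S.card < U.card by omega)
        exact ⟨x, hx, by simp [hx', hc]⟩
    have h1 : (U.erase x).card = n := by
      rw [Finset.card_erase_of_mem hxU, hn]
      rfl
    have h2 : (S.erase x).card = trues c (r + 1) (U.erase x).card := by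
      rw [h1]
      by_cases hxS : x ∈ S
      · rw [Finset.card_erase_of_mem hxS, hcard, if_pos (by rw [← hx]; simpa using hxS)]
        rfl
      · rw [Finset.erase_eq_of_notMem hxS, hcard,
          if_neg (by rw [← hx]; simpa using hxS), add_zero]
    obtain ⟨L, hL1, hL2, hL3⟩ := ih (r + 1) (U.erase x) (S.erase x)
      (Finset.erase_subset_erase x hS) h2 h1
    refine ⟨x :: L, List.nodup_cons.mpr ⟨fun h => by simpa using (hL2 x).mp h, hL1⟩, ?_, ?_⟩
    · intro y
      rw [List.mem_cons, hL2, Finset.mem_erase]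
      by_cases hyx : y = x
      · simp [hyx, hxU]
      · simp [hyx]
    · rw [List.map_cons, hx, word_succ', ← hL3]
      congr 1
      refine List.map_congr_left fun y hy => ?_
      have := (hL2 y).mp hy
      rw [Finset.mem_erase] at this
      simp [this.1]

section Lower

variable {F : Type*} [Field F] {X : Type*}
variable {B : Type*} [NonUnitalNonAssocRing B] [Module F B] [IsScalarTower F B B]
  [SMulCommClass F B B] {c : ℕ → Bool} {bas : Atom → B}

/-- The left-normed commutator `[…[[f, x₁], x₂], …, xₖ]`. -/
def leftComm (F : Type*) [Field F] {X : Type*} :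
    FreeNonUnitalNonAssocAlgebra F X → List X → FreeNonUnitalNonAssocAlgebra F X
  | f, [] => f
  | f, x :: L => leftComm F (f * .of F x - .of F x * f) L

/-- The left-normed product `(…((f x₁) x₂) …) xₖ`. -/
def leftMul (F : Type*) [Field F] {X : Type*} :
    FreeNonUnitalNonAssocAlgebra F X → List X → FreeNonUnitalNonAssocAlgebra F X
  | f, [] => f
  | f, x :: L => leftMul F (f * .of F x) L

lemma leftComm_mem {f : FreeNonUnitalNonAssocAlgebra F X} {m : Multiset X}
    (hf : f ∈ monomialSpan F m) (L : List X) :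
    leftComm F f L ∈ monomialSpan F (m + (L : Multiset X)) := by
  induction L generalizing f m with
  | nil => simpa [leftComm] using hf
  | cons x L ih =>
    have h1 := mul_mem_monomialSpan hf (of_mem_monomialSpan (F := F) x)
    have h2 := mul_mem_monomialSpan (of_mem_monomialSpan (F := F) x) hf
    rw [add_comm] at h2
    have := ih (sub_mem h1 h2)
    rwa [add_assoc, Multiset.singleton_add, Multiset.cons_coe] at this

lemma leftMul_mem {f : FreeNonUnitalNonAssocAlgebra F X} {m : Multiset X}
    (hf : f ∈ monomialSpan F m) (L : List X) :
    leftMul F f L ∈ monomialSpan F (m + (L : Multiset X)) := by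
  induction L generalizing f m with
  | nil => simpa [leftMul] using hf
  | cons x L ih =>
    have := ih (mul_mem_monomialSpan hf (of_mem_monomialSpan (F := F) x))
    rwa [add_assoc, Multiset.singleton_add, Multiset.cons_coe] at this

/-- The generator which moves the chain on at a letter of the word. -/
def Atom.ofBool (x : Bool) : Atom := if x then .b else .a

lemma Atom.ofBool_injective : Function.Injective Atom.ofBool := by
  intro x y
  cases x <;> cases y <;> simp [Atom.ofBool]

lemma lift_leftComm_of_eq_zero {φ : X → B} {f : FreeNonUnitalNonAssocAlgebra F X}
    (hf : FreeNonUnitalNonAssocAlgebra.lift F φ f = 0) (L : List X) :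
    FreeNonUnitalNonAssocAlgebra.lift F φ (leftComm F f L) = 0 := by
  induction L generalizing f with
  | nil => exact hf
  | cons x L ih => exact ih (by rw [map_sub, map_mul, map_mul, hf, zero_mul, mul_zero, sub_zero])

lemma lift_leftMul_of_eq_zero {φ : X → B} {f : FreeNonUnitalNonAssocAlgebra F X}
    (hf : FreeNonUnitalNonAssocAlgebra.lift F φ f = 0) (L : List X) :
    FreeNonUnitalNonAssocAlgebra.lift F φ (leftMul F f L) = 0 := by
  induction L generalizing f with
  | nil => exact hf
  | cons x L ih => exact ih (by rw [map_mul, hf, zero_mul])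

open Classical in
/-- A left-normed commutator starting in the chain vanishes unless its other entries spell the
word of the chain; in particular the unit must not occur among them. -/
lemma IsChain.lift_leftComm (hB : IsChain F c bas) {φ : X → B} {g : X → Atom}
    {f : FreeNonUnitalNonAssocAlgebra F X} {r : ℕ}
    (hf : FreeNonUnitalNonAssocAlgebra.lift F φ f = bas (.u r)) (L : List X)
    (hφ : ∀ x ∈ L, φ x = bas (g x)) (hg : ∀ x ∈ L, ∀ t, g x ≠ .u t) :
    FreeNonUnitalNonAssocAlgebra.lift F φ (leftComm F f L) =
      if L.map g = (word c r L.length).map Atom.ofBool then bas (.u (r + L.length)) else 0 := by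
  induction L generalizing f r with
  | nil => simpa [leftComm, word] using hf
  | cons x L ih =>
    have hφ' : ∀ y ∈ L, φ y = bas (g y) := fun y hy => hφ y (List.mem_cons_of_mem x hy)
    have hg' : ∀ y ∈ L, ∀ t, g y ≠ .u t := fun y hy => hg y (List.mem_cons_of_mem x hy)
    have hx := hφ x List.mem_cons_self
    have h1 : FreeNonUnitalNonAssocAlgebra.lift F φ (f * .of F x - .of F x * f) =
        if g x = Atom.ofBool (c r) then bas (.u (r + 1)) else 0 := by
      rw [map_sub, map_mul, map_mul, FreeNonUnitalNonAssocAlgebra.lift_of_apply, hf, hx, hB.mul_eq,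
        hB.mul_eq]
      cases hgx : g x with
      | u t => exact absurd hgx (hg x List.mem_cons_self t)
      | _ => cases hc : c r <;> simp [Atom.mul, Atom.ofBool, hc]
    simp only [List.map_cons, List.length_cons, word_succ', List.cons_eq_cons, leftComm]
    by_cases hgx : g x = Atom.ofBool (c r)
    · rw [if_pos hgx] at h1
      rw [ih h1 hφ' hg']
      simp only [hgx, true_and, add_assoc, add_comm 1]
    · rw [if_neg hgx] at h1
      rw [lift_leftComm_of_eq_zero h1, if_neg (fun h => hgx h.1)]

lemma IsChain.lift_leftMul (hB : IsChain F c bas) {φ : X → B}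
    {f : FreeNonUnitalNonAssocAlgebra F X} {r : ℕ}
    (hf : FreeNonUnitalNonAssocAlgebra.lift F φ f = bas (.u r)) (L : List X)
    (hφ : ∀ x ∈ L, φ x = bas .one) :
    FreeNonUnitalNonAssocAlgebra.lift F φ (leftMul F f L) = bas (.u r) := by
  induction L generalizing f with
  | nil => exact hf
  | cons x L ih =>
    refine ih ?_ fun y hy => hφ y (List.mem_cons_of_mem x hy)
    rw [map_mul, hf, FreeNonUnitalNonAssocAlgebra.lift_of_apply, hφ x List.mem_cons_self, hB.mul_eq]
    rfl

lemma pattern_eq_ofBool {n : ℕ} {i₀ i : Fin n} {U S : Finset (Fin n)} (h0 : i₀ ∉ U) (hi : i ∈ U)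
    (y : Atom) : pattern i₀ U S y i = Atom.ofBool (decide (i ∈ S)) := by
  have : i ≠ i₀ := fun h => h0 (h ▸ hi)
  by_cases hS : i ∈ S <;> simp [pattern, this, hi, hS, Atom.ofBool]

lemma pattern_eq_one {n : ℕ} {i₀ i : Fin n} {U S : Finset (Fin n)} (hS : S ⊆ U) (h0 : i ≠ i₀)
    (hi : i ∉ U) (y : Atom) : pattern i₀ U S y i = .one := by
  have : i ∉ S := fun h => hi (hS h)
  simp [pattern, h0, hi, this]

/-- The pairs `S ⊆ U` of sets of variables other than the first one, of fixed cardinalities, such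
that the first subword of length `j` can be read off by the variables in `U`, with those in `S`
replaced by `b` and the others by `a`. -/
def readingPairs (c : ℕ → Bool) (N j : ℕ) :
    Finset (Σ _ : Finset (Fin (N + 1)), Finset (Fin (N + 1))) :=
  (Finset.powersetCard j (Finset.univ.erase 0)).sigma fun U =>
    Finset.powersetCard (trues c 0 j) U

lemma card_readingPairs (c : ℕ → Bool) (N j : ℕ) :
    (readingPairs c N j).card = N.choose j * j.choose (trues c 0 j) := by
  rw [readingPairs, Finset.card_sigma, Finset.sum_congr rfl fun U hU => by
    rw [Finset.card_powersetCard, (Finset.mem_powersetCard.mp hU).2], Finset.sum_const,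
    Finset.card_powersetCard, Finset.card_erase_of_mem (Finset.mem_univ _), Finset.card_univ,
    Fintype.card_fin, smul_eq_mul]
  rfl

lemma mem_readingPairs {N j : ℕ} {p : Σ _ : Finset (Fin (N + 1)), Finset (Fin (N + 1))} :
    p ∈ readingPairs c N j ↔
      (0 ∉ p.1 ∧ p.1.card = j) ∧ p.2 ⊆ p.1 ∧ p.2.card = trues c 0 j := by
  rw [readingPairs, Finset.mem_sigma, Finset.mem_powersetCard, Finset.mem_powersetCard]
  simp only [Finset.subset_erase, Finset.subset_univ, true_and]

/-- The codimension is at least the number of admissible reading pairs: the products of left-normed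
commutators in the variables of `U`, ordered suitably, with the remaining variables are dual to
the substitutions given by the reading pairs. -/
theorem IsChain.card_le_finrank (hB : IsChain F c bas) {N : ℕ} (e : Fin (N + 1) ↪ X)
    (T : X → Set Atom) (j : ℕ) (P : Finset (Σ _ : Finset (Fin (N + 1)), Finset (Fin (N + 1))))
    (hP : P ⊆ readingPairs c N j)
    (hPT : ∀ p ∈ P, ∀ i, pattern 0 p.1 p.2 (.u 0) i ∈ T (e i))
    [Module.Finite F (multilinear F (Finset.univ.map e) ⧸
        (identitiesOn fun x => Submodule.span F (bas '' T x)).submoduleOf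
          (multilinear F (Finset.univ.map e)))] :
    P.card ≤ Module.finrank F (multilinear F (Finset.univ.map e) ⧸
        (identitiesOn fun x => Submodule.span F (bas '' T x)).submoduleOf
          (multilinear F (Finset.univ.map e))) := by
  classical
  have hlist : ∀ p : Σ _ : Finset (Fin (N + 1)), Finset (Fin (N + 1)), ∃ L : List (Fin (N + 1)),
      p ∈ P → L.Nodup ∧ (∀ x, x ∈ L ↔ x ∈ p.1) ∧
        L.map (fun x => decide (x ∈ p.2)) = word c 0 p.1.card := by
    intro p
    by_cases hp : p ∈ P
    · obtain ⟨⟨h1, h2⟩, h3, h4⟩ := mem_readingPairs.mp (hP hp)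
      obtain ⟨L, hL⟩ := exists_list_map_eq_word c 0 p.1 p.2 h3 (by rw [h4, h2])
      exact ⟨L, fun _ => hL⟩
    · exact ⟨[], fun h => absurd h hp⟩
  choose L hL using hlist
  let M : (Σ _ : Finset (Fin (N + 1)), Finset (Fin (N + 1))) → List (Fin (N + 1)) := fun p =>
    (Finset.univ \ insert 0 p.1).toList
  let φ : (Σ _ : Finset (Fin (N + 1)), Finset (Fin (N + 1))) → X → B := fun p =>
    Function.extend e (fun i => bas (pattern 0 p.1 p.2 (.u 0) i)) fun _ => 0
  have hφ : ∀ p i, φ p (e i) = bas (pattern 0 p.1 p.2 (.u 0) i) := fun p i =>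
    e.injective.extend_apply _ _ _
  let f : (Σ _ : Finset (Fin (N + 1)), Finset (Fin (N + 1))) → FreeNonUnitalNonAssocAlgebra F X :=
    fun p => leftComm F (.of F (e 0)) ((L p).map e)
  obtain ⟨l, hl⟩ := hB.exists_coord (.u j)
  have hcomm : ∀ p ∈ P, ∀ q ∈ P, FreeNonUnitalNonAssocAlgebra.lift F (φ p) (f q) =
      if p = q then bas (.u j) else 0 := by
    intro p hp q hq
    obtain ⟨⟨hp1, hp2⟩, hp3, hp4⟩ := mem_readingPairs.mp (hP hp)
    obtain ⟨⟨hq1, hq2⟩, hq3, hq4⟩ := mem_readingPairs.mp (hP hq)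
    obtain ⟨hLn, hLU, hLw⟩ := hL q hq
    have hlen : (L q).length = j := by
      have := congrArg List.length hLw
      rwa [List.length_map, length_word, hq2] at this
    have h0 : FreeNonUnitalNonAssocAlgebra.lift F (φ p) (.of F (e 0)) = bas (.u 0) := by
      rw [FreeNonUnitalNonAssocAlgebra.lift_of_apply, hφ]
      simp [pattern]
    have h1 := hB.lift_leftComm (g := extendAtom e (pattern 0 p.1 p.2 (.u 0))) h0 ((L q).map e)
      (by
        intro x hx
        obtain ⟨i, -, rfl⟩ := List.mem_map.mp hx
        rw [hφ, extendAtom_apply])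
      (by
        intro x hx t
        obtain ⟨i, hi, rfl⟩ := List.mem_map.mp hx
        have : i ≠ 0 := fun h => hq1 (h ▸ (hLU i).mp hi)
        rw [extendAtom_apply]
        simp only [pattern, this, if_false]
        split_ifs <;> simp)
    rw [List.length_map, hlen, zero_add, List.map_map] at h1
    rw [h1]
    refine if_congr ?_ rfl rfl
    have hw : (word c 0 j).map Atom.ofBool =
        (L q).map fun i => Atom.ofBool (decide (i ∈ q.2)) := by
      rw [← hq2, ← hLw, List.map_map]
      rfl
    rw [hw, List.map_inj_left]
    simp only [Function.comp_apply, extendAtom_apply, hLU]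
    constructor
    · intro h
      -- the commutator vanishes if an entry is the unit, so its variables all lie in `p.1`
      have hsub : q.1 ⊆ p.1 := by
        intro i hi
        by_contra hip
        have h2 := h i hi
        rw [pattern_eq_one hp3 (show i ≠ 0 from fun h => hq1 (h ▸ hi)) hip] at h2
        cases hd : decide (i ∈ q.2) <;> rw [hd] at h2 <;> simp [Atom.ofBool] at h2
      have hU : q.1 = p.1 := Finset.eq_of_subset_of_card_le hsub (by rw [hp2, hq2])
      have hS : p.2 = q.2 := by
        ext i
        by_cases hi : i ∈ q.1
        · have h2 := h i hi
          rw [pattern_eq_ofBool hp1 (hsub hi)] at h2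
          simpa using Atom.ofBool_injective h2
        · exact ⟨fun h => absurd (hU ▸ hp3 h) hi, fun h => absurd (hq3 h) hi⟩
      exact Sigma.ext hU.symm (heq_of_eq hS)
    · rintro rfl i hi
      exact pattern_eq_ofBool hp1 hi _
  refine card_le_finrank_quotient P _ _ (fun p => leftMul F (f p) ((M p).map e)) ?_
    (fun p => l.comp ((FreeNonUnitalNonAssocAlgebra.lift F (φ p) :
      FreeNonUnitalNonAssocAlgebra F X →ₙₐ[F] B) : FreeNonUnitalNonAssocAlgebra F X →ₗ[F] B))
    ?_ ?_ ?_
  · intro p hp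
    obtain ⟨⟨hp1, -⟩, -, -⟩ := mem_readingPairs.mp (hP hp)
    obtain ⟨hLn, hLU, -⟩ := hL p hp
    have h1 := leftMul_mem (leftComm_mem (of_mem_monomialSpan (F := F) (e 0)) ((L p).map e))
      ((M p).map e)
    rw [multilinear_eq_monomialSpan]
    convert h1 using 2
    rw [Finset.map_val, ← Multiset.map_coe, ← Multiset.map_coe, ← Multiset.map_singleton,
      ← Multiset.map_add, ← Multiset.map_add]
    congr 1
    have hLeq : ((L p : List (Fin (N + 1))) : Multiset (Fin (N + 1))) = p.1.val :=
      (Multiset.Nodup.ext (Multiset.coe_nodup.mpr hLn) p.1.nodup).mpr hLU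
    rw [hLeq, Finset.coe_toList, Multiset.singleton_add,
      ← Finset.insert_val_of_notMem hp1, Finset.sdiff_val]
    exact (add_tsub_cancel_of_le (Finset.val_le_iff.mpr (Finset.subset_univ _))).symm
  · intro p hp g hg
    have h0 : FreeNonUnitalNonAssocAlgebra.lift F (φ p) g = 0 := by
      refine hg _ fun x => ?_
      by_cases hx : ∃ i, e i = x
      · obtain ⟨i, rfl⟩ := hx
        rw [hφ]
        exact Submodule.subset_span ⟨_, hPT p hp i, rfl⟩
      · simp only [φ, Function.extend_apply' _ _ _ hx]
        exact zero_mem _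
    change l (FreeNonUnitalNonAssocAlgebra.lift F (φ p) g) = 0
    rw [h0, map_zero]
  · intro p hp
    obtain ⟨⟨hp1, -⟩, hp3, -⟩ := mem_readingPairs.mp (hP hp)
    have h1 := hcomm p hp p hp
    rw [if_pos rfl] at h1
    have h2 := hB.lift_leftMul h1 ((M p).map e) (by
      intro x hx
      obtain ⟨i, hi, rfl⟩ := List.mem_map.mp hx
      simp only [M, Finset.mem_toList, Finset.mem_sdiff, Finset.mem_univ, true_and,
        Finset.mem_insert, not_or] at hi
      rw [hφ, pattern_eq_one hp3 hi.1 hi.2])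
    change l (FreeNonUnitalNonAssocAlgebra.lift F (φ p) (leftMul F (f p) ((M p).map e))) ≠ 0
    rw [h2, hl]
    exact one_ne_zero
  · intro p hp q hq hpq
    have h1 := hcomm p hp q hq
    rw [if_neg hpq] at h1
    change l (FreeNonUnitalNonAssocAlgebra.lift F (φ p) (leftMul F (f q) ((M q).map e))) = 0
    rw [lift_leftMul_of_eq_zero h1, map_zero]

end Lower

/-! ### Summation over the parities of the variables -/

section Parity

variable {F : Type*} [Field F]
variable {B : Type*} [NonUnitalNonAssocRing B] [Module F B] [IsScalarTower F B B]
  [SMulCommClass F B B] {c : ℕ → Bool} {bas : Atom → B}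

/-- An enumeration of the graded variables in which the even ones have the indices in `s`. -/
lemma exists_embedding_gradedVars {n : ℕ} (s : Finset (Fin n)) :
    ∃ e : Fin n ↪ ℕ ⊕ ℕ, Finset.univ.map e = gradedVars s.card (n - s.card) ∧
      (∀ i ∈ s, ∃ k, e i = Sum.inl k) ∧ ∀ i ∉ s, ∃ k, e i = Sum.inr k := by
  classical
  let e : Fin n → ℕ ⊕ ℕ := fun i => if h : i ∈ s then Sum.inl (s.equivFin ⟨i, h⟩ : ℕ)
    else Sum.inr (sᶜ.equivFin ⟨i, Finset.mem_compl.mpr h⟩ : ℕ)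
  have he1 : ∀ i (h : i ∈ s), e i = Sum.inl (s.equivFin ⟨i, h⟩ : ℕ) := fun i h => dif_pos h
  have he2 : ∀ i (h : i ∉ s), e i = Sum.inr (sᶜ.equivFin ⟨i, Finset.mem_compl.mpr h⟩ : ℕ) :=
    fun i h => dif_neg h
  have hinj : Function.Injective e := by
    intro i j hij
    by_cases hi : i ∈ s <;> by_cases hj : j ∈ s
    · rw [he1 i hi, he1 j hj, Sum.inl.injEq] at hij
      simpa using s.equivFin.injective (Fin.ext hij)
    · rw [he1 i hi, he2 j hj] at hij
      simp at hij
    · rw [he2 i hi, he1 j hj] at hij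
      simp at hij
    · rw [he2 i hi, he2 j hj, Sum.inr.injEq] at hij
      simpa using sᶜ.equivFin.injective (Fin.ext hij)
  have hcompl : sᶜ.card = n - s.card := by rw [Finset.card_compl, Fintype.card_fin]
  refine ⟨⟨e, hinj⟩, ?_, fun i hi => ⟨_, he1 i hi⟩, fun i hi => ⟨_, he2 i hi⟩⟩
  refine Finset.eq_of_subset_of_card_le ?_ ?_
  · intro x hx
    obtain ⟨i, -, rfl⟩ := Finset.mem_map.mp hx
    change e i ∈ _
    by_cases hi : i ∈ s
    · rw [he1 i hi, gradedVars, Finset.inl_mem_disjSum, Finset.mem_range]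
      exact Fin.is_lt _
    · rw [he2 i hi, gradedVars, Finset.inr_mem_disjSum, Finset.mem_range, ← hcompl]
      exact Fin.is_lt _
  · rw [Finset.card_map, gradedVars, Finset.card_disjSum, Finset.card_range, Finset.card_range,
      Finset.card_univ, Fintype.card_fin]
    have := Finset.card_le_univ s
    rw [Fintype.card_fin] at this
    omega

/-- The substitutions allowed for the graded variables, given those for each parity. -/
def gradedSubst (T : ZMod 2 → Set Atom) : ℕ ⊕ ℕ → Set Atom :=
  Sum.elim (fun _ => T 0) fun _ => T 1

lemma gradedSubst_embedding {n : ℕ} {s : Finset (Fin n)} {e : Fin n ↪ ℕ ⊕ ℕ}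
    (h1 : ∀ i ∈ s, ∃ k, e i = Sum.inl k) (h2 : ∀ i ∉ s, ∃ k, e i = Sum.inr k)
    (T : ZMod 2 → Set Atom) {deg : Atom → ZMod 2} (hdeg : ∀ d, ∀ y ∈ T d, deg y = d) :
    ∀ h : Fin n → Atom, (∀ i, h i ∈ gradedSubst T (e i)) ↔
      (Finset.univ.filter fun i => deg (h i) = 0) = s ∧ ∀ i, h i ∈ T (deg (h i)) := by
  intro h
  have key : ∀ i, h i ∈ gradedSubst T (e i) ↔ (deg (h i) = 0 ↔ i ∈ s) ∧ h i ∈ T (deg (h i)) := by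
    intro i
    by_cases hi : i ∈ s
    · obtain ⟨k, hk⟩ := h1 i hi
      rw [hk]
      simp only [gradedSubst, Sum.elim_inl, hi, iff_true]
      exact ⟨fun h => ⟨hdeg 0 _ h, (hdeg 0 _ h).symm ▸ h⟩, fun h => h.1 ▸ h.2⟩
    · obtain ⟨k, hk⟩ := h2 i hi
      rw [hk]
      simp only [gradedSubst, Sum.elim_inr, hi, iff_false]
      have h3 : ∀ d : ZMod 2, d ≠ 0 → d = 1 := by decide
      exact ⟨fun h => ⟨by rw [hdeg 1 _ h]; exact one_ne_zero, (hdeg 1 _ h).symm ▸ h⟩,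
        fun h => h3 _ h.1 ▸ h.2⟩
  simp only [key, forall_and, Finset.ext_iff, Finset.mem_filter, Finset.mem_univ, true_and]

lemma sum_choose_mul_eq (n : ℕ) (f : ℕ → ℕ → ℕ) :
    ∑ k ∈ Finset.range (n + 1), n.choose k * f k (n - k) =
      ∑ s : Finset (Fin n), f s.card (n - s.card) := by
  have := Finset.sum_powerset_apply_card (fun k => f k (n - k))
    (x := (Finset.univ : Finset (Fin n)))
  rw [Finset.powerset_univ, Finset.card_univ, Fintype.card_fin] at this
  rw [this]
  simp

variable (F) in
/-- The partial codimension with respect to the allowed substitutions `T`. -/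
def substCodim (bas : Atom → B) (T : ZMod 2 → Set Atom) (k l : ℕ) : ℕ :=
  Module.finrank F (multilinear F (gradedVars k l) ⧸
    (identitiesOn fun x => Submodule.span F (bas '' gradedSubst T x)).submoduleOf
      (multilinear F (gradedVars k l)))

/-- Each pattern is admissible for one parity of its variables at most. -/
theorem IsChain.sum_substCodim_le (hB : IsChain F c bas) (deg : Atom → ZMod 2) {n : ℕ}
    (hn : 0 < n) (T : ZMod 2 → Set Atom) (hdeg : ∀ d, ∀ y ∈ T d, deg y = d)
    (hT : ∀ d t t', Atom.u t ∈ T d → deg (.u t') = deg (.u t) → Atom.u t' ∈ T d)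
    (𝒰 : Fin n → Finset (Finset (Fin n)))
    (h𝒰 : ∀ h : Fin n → Atom, (∀ i, h i ∈ T (deg (h i))) → ∀ i₀, ∀ U : Finset (Fin n),
      (∀ i, i ∈ U ↔ i ≠ i₀ ∧ h i ≠ .one) → U ∈ 𝒰 i₀) :
    ∑ k ∈ Finset.range (n + 1), n.choose k * substCodim F bas T k (n - k) ≤
      (patterns c deg 𝒰).card := by
  classical
  rw [sum_choose_mul_eq, Finset.card_eq_sum_card_fiberwise
    (f := fun h => Finset.univ.filter fun i => deg (h i) = 0) (t := Finset.univ)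
    (fun _ _ => Finset.mem_coe.mpr (Finset.mem_univ _))]
  refine Finset.sum_le_sum fun s _ => ?_
  obtain ⟨e, he, h1, h2⟩ := exists_embedding_gradedVars s
  have key := gradedSubst_embedding h1 h2 T hdeg
  rw [substCodim, ← he]
  refine (hB.finrank_le deg hn e (gradedSubst T) ?_ 𝒰 ?_ _ ?_).2
  · rintro (x | x) t t'
    exacts [hT 0 t t', hT 1 t t']
  · exact fun h hh => h𝒰 h ((key h).mp hh).2
  · intro h hh hh'
    exact Finset.mem_filter.mpr ⟨hh, ((key h).mp hh').1⟩

/-- Each reading pair is admissible for some parity of its variables. -/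
theorem IsChain.le_sum_substCodim (hB : IsChain F c bas) (deg : Atom → ZMod 2) {N j : ℕ}
    (T : ZMod 2 → Set Atom) (hdeg : ∀ d, ∀ y ∈ T d, deg y = d)
    (hT : ∀ d t t', Atom.u t ∈ T d → deg (.u t') = deg (.u t) → Atom.u t' ∈ T d)
    (hPT : ∀ p ∈ readingPairs c N j, ∀ i,
      pattern 0 p.1 p.2 (.u 0) i ∈ T (deg (pattern 0 p.1 p.2 (.u 0) i))) :
    N.choose j * j.choose (trues c 0 j) ≤
      ∑ k ∈ Finset.range (N + 1 + 1), (N + 1).choose k * substCodim F bas T k (N + 1 - k) := by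
  classical
  rw [sum_choose_mul_eq, ← card_readingPairs, Finset.card_eq_sum_card_fiberwise
    (f := fun p => Finset.univ.filter fun i => deg (pattern 0 p.1 p.2 (.u 0) i) = 0)
    (t := Finset.univ) (fun _ _ => Finset.mem_coe.mpr (Finset.mem_univ _))]
  refine Finset.sum_le_sum fun s _ => ?_
  obtain ⟨e, he, h1, h2⟩ := exists_embedding_gradedVars s
  have key := gradedSubst_embedding h1 h2 T hdeg
  rw [substCodim, ← he]
  have hfin := (hB.finrank_le deg N.succ_pos e (gradedSubst T) (by
    rintro (x | x) t t'
    exacts [hT 0 t t', hT 1 t t']) (fun _ => Finset.univ) (fun _ _ _ _ _ => Finset.mem_univ _)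
    _ (fun h hh _ => hh)).1
  refine hB.card_le_finrank e (gradedSubst T) j _ (Finset.filter_subset _ _) ?_
  intro p hp
  rw [Finset.mem_filter] at hp
  exact (key _).mpr ⟨hp.2, hPT p hp.1⟩

end Parity

/-! ### The algebra `A(K)` as a chain algebra and its gradings -/

section Algebra

variable {F : Type*} [Field F] {K : ℕ → ℕ}

/-- The basis of the algebra `A(K)`, with the elements `z i j` in their natural order; the value at
`one` is irrelevant. -/
def atomAlg (F : Type*) [Field F] (K : ℕ → ℕ) : Atom → Alg F K
  | .one => 0
  | .a => Alg.a F K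
  | .b => Alg.b F K
  | .u t => Alg.z F K (position K t).1 (position K t).2

/-- The basis of the algebra `A(K)` with external unit. -/
def atomUnit (F : Type*) [Field F] (K : ℕ → ℕ) : Atom → Unitization F (Alg F K)
  | .one => 1
  | y => Unitization.inr (atomAlg F K y)

lemma atomUnit_of_ne_one {y : Atom} (hy : y ≠ .one) :
    atomUnit F K y = Unitization.inr (atomAlg F K y) := by
  cases y with
  | one => exact absurd rfl hy
  | _ => rfl

lemma basis_mul_basis (x y : Idx K) :
    Alg.basis F K x * Alg.basis F K y = Alg.table F K x y := by
  change Alg.mulHom F K (Alg.basis F K x) (Alg.basis F K y) = _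
  simp [Alg.mulHom]

/-- The position in the basis of a basis element. -/
def atomIdx (hK : ∀ i, 0 < K i) : Atom → Idx K
  | .one => .a
  | .a => .a
  | .b => .b
  | .u t => .z (position K t).1 ⟨(position K t).2, position_lt hK t⟩

lemma atomAlg_eq_basis (hK : ∀ i, 0 < K i) {y : Atom} (hy : y ≠ .one) :
    atomAlg F K y = Alg.basis F K (atomIdx hK y) := by
  cases y with
  | one => exact absurd rfl hy
  | a => rfl
  | b => rfl
  | u t => simp [atomAlg, Alg.z, atomIdx, position_lt hK t]

lemma atomAlg_mul (hK : ∀ i, 0 < K i) {x y : Atom} (hx : x ≠ .one) (hy : y ≠ .one) :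
    atomAlg F K x * atomAlg F K y = (Atom.mul (isLast K) x y).elim 0 (atomAlg F K) := by
  rw [atomAlg_eq_basis hK hx, atomAlg_eq_basis hK hy, basis_mul_basis]
  have hz : ∀ i, Alg.z F K i (K i) = 0 := fun i => by simp [Alg.z]
  cases x with
  | one => exact absurd rfl hx
  | a => cases y <;> first | exact absurd rfl hy | rfl
  | b => cases y <;> first | exact absurd rfl hy | rfl
  | u t =>
    cases y with
    | one => exact absurd rfl hy
    | a =>
      by_cases h : (position K t).2 + 1 = K (position K t).1
      · simp [atomIdx, Alg.table, Atom.mul, isLast, h, hz]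
      · simp [atomIdx, Alg.table, Atom.mul, isLast, h, atomAlg, position]
    | b =>
      by_cases h : (position K t).2 + 1 = K (position K t).1
      · simp [atomIdx, Alg.table, Atom.mul, isLast, h, atomAlg, position]
      · simp [atomIdx, Alg.table, Atom.mul, isLast, h]
    | u s => rfl

lemma Atom.ne_one_of_mul_eq_some {c : ℕ → Bool} {x y z : Atom} (hx : x ≠ .one) (hy : y ≠ .one)
    (h : Atom.mul c x y = some z) : z ≠ .one := by
  rintro rfl
  cases x <;> cases y <;> simp [Atom.mul] at h hx hy

lemma isChain_atomUnit (hK : ∀ i, 0 < K i) : IsChain F (isLast K) (atomUnit F K) where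
  mul_eq x y := by
    by_cases hx : x = .one
    · subst hx
      exact one_mul _
    by_cases hy : y = .one
    · subst hy
      have : Atom.mul (isLast K) x .one = some x := by cases x <;> rfl
      rw [this]
      exact mul_one _
    rw [atomUnit_of_ne_one hx, atomUnit_of_ne_one hy, ← Unitization.inr_mul, atomAlg_mul hK hx hy]
    cases h : Atom.mul (isLast K) x y with
    | none => exact Unitization.inr_zero F
    | some z => exact (atomUnit_of_ne_one (Atom.ne_one_of_mul_eq_some hx hy h)).symm
  exists_coord y := by
    by_cases hy : y = .one
    · subst hy
      exact ⟨{ toFun := fun x => x.fst, map_add' := fun _ _ => rfl, map_smul' := fun _ _ => rfl },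
        rfl⟩
    · refine ⟨((Alg.basis F K).coord (atomIdx hK y)).comp (Unitization.sndHom F F (Alg F K)), ?_⟩
      rw [atomUnit_of_ne_one hy, atomAlg_eq_basis hK hy]
      simp

lemma span_atomAlg (hK : ∀ i, 0 < K i) :
    Submodule.span F (atomAlg F K '' {y | y ≠ .one}) = ⊤ := by
  rw [eq_top_iff, ← (Alg.basis F K).span_eq, Submodule.span_le]
  rintro _ ⟨x, rfl⟩
  refine Submodule.subset_span ?_
  cases x with
  | a => exact ⟨.a, by simp, rfl⟩
  | b => exact ⟨.b, by simp, rfl⟩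
  | z i j =>
    obtain ⟨t, ht⟩ := exists_position_eq hK i j j.2
    have h1 : (position K t).1 = i := by rw [ht]
    have h2 : (position K t).2 = j := by rw [ht]
    exact ⟨.u t, by simp, by rw [atomAlg, h1, h2, Alg.z, dif_pos j.2]⟩

/-- The degrees of the basis elements, computed from those of `a`, `b` and the first element of the
chain. -/
def atomDeg (c : ℕ → Bool) (da db dz : ZMod 2) : Atom → ZMod 2
  | .one => 0
  | .a => da
  | .b => db
  | .u t => dz + ∑ l ∈ Finset.range t, if c l then db else da

variable {𝒜 : ZMod 2 → Submodule F (Alg F K)} {da db dz : ZMod 2}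

lemma atomAlg_mem (hK : ∀ i, 0 < K i) (hmul : SetLike.GradedMul 𝒜) (ha : Alg.a F K ∈ 𝒜 da)
    (hb : Alg.b F K ∈ 𝒜 db) (hz : Alg.z F K 0 0 ∈ 𝒜 dz) (y : Atom) :
    atomAlg F K y ∈ 𝒜 (atomDeg (isLast K) da db dz y) := by
  cases y with
  | one => exact zero_mem _
  | a => exact ha
  | b => exact hb
  | u t =>
    induction t with
    | zero => simpa [atomDeg, atomAlg, position] using hz
    | succ t ih =>
      rw [atomDeg, Finset.sum_range_succ, ← add_assoc]
      cases hc : isLast K t with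
      | true =>
        have := atomAlg_mul (F := F) hK (x := .u t) (y := .b) (by simp) (by simp)
        simp only [Atom.mul, hc, if_true, Option.elim] at this
        rw [← this]
        exact hmul.mul_mem ih hb
      | false =>
        have := atomAlg_mul (F := F) hK (x := .u t) (y := .a) (by simp) (by simp)
        simp only [Atom.mul, hc, Bool.false_eq_true, if_false, Option.elim] at this
        rw [← this]
        exact hmul.mul_mem ih ha

/-- A grading for which `a`, `b` and the first element of the chain are homogeneous is spanned by
basis elements. -/
lemma grading_eq_span (hK : ∀ i, 0 < K i) (hdecomp : DirectSum.IsInternal 𝒜)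
    (hmul : SetLike.GradedMul 𝒜) (ha : Alg.a F K ∈ 𝒜 da) (hb : Alg.b F K ∈ 𝒜 db)
    (hz : Alg.z F K 0 0 ∈ 𝒜 dz) (d : ZMod 2) :
    𝒜 d = Submodule.span F
      (atomAlg F K '' {y | y ≠ .one ∧ atomDeg (isLast K) da db dz y = d}) := by
  set deg := atomDeg (isLast K) da db dz with hdeg
  set M : ZMod 2 → Submodule F (Alg F K) := fun d =>
    Submodule.span F (atomAlg F K '' {y | y ≠ .one ∧ deg y = d}) with hM
  have hle : ∀ d, M d ≤ 𝒜 d := by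
    intro d
    rw [hM, Submodule.span_le]
    rintro _ ⟨y, ⟨-, rfl⟩, rfl⟩
    exact atomAlg_mem hK hmul ha hb hz y
  have hdd : ∀ d : ZMod 2, d ≠ d + 1 := by decide
  have hcases : ∀ d d' : ZMod 2, d' = d ∨ d' = d + 1 := by decide
  have hsup : M d ⊔ M (d + 1) = ⊤ := by
    rw [eq_top_iff, ← span_atomAlg hK, Submodule.span_le]
    rintro _ ⟨y, hy, rfl⟩
    rcases hcases d (deg y) with h | h
    · exact Submodule.mem_sup_left (Submodule.subset_span ⟨y, ⟨hy, h⟩, rfl⟩)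
    · exact Submodule.mem_sup_right (Submodule.subset_span ⟨y, ⟨hy, h⟩, rfl⟩)
  have hdisj : 𝒜 (d + 1) ⊓ 𝒜 d = ⊥ :=
    (hdecomp.submodule_iSupIndep.pairwiseDisjoint (hdd d).symm).eq_bot
  refine le_antisymm ?_ (hle d)
  calc 𝒜 d = (M d ⊔ M (d + 1)) ⊓ 𝒜 d := by rw [hsup, top_inf_eq]
    _ = M d ⊔ M (d + 1) ⊓ 𝒜 d := sup_inf_assoc_of_le _ (hle d)
    _ ≤ M d ⊔ 𝒜 (d + 1) ⊓ 𝒜 d := sup_le_sup_left (inf_le_inf_right _ (hle (d + 1))) _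
    _ = M d := by rw [hdisj, sup_bot_eq]

lemma map_inr_span (S : Set Atom) (hS : ∀ y ∈ S, y ≠ .one) :
    (Submodule.span F (atomAlg F K '' S)).map (Unitization.inrHom F F (Alg F K)) =
      Submodule.span F (atomUnit F K '' S) := by
  rw [Submodule.map_span, Set.image_image]
  congr 1
  exact Set.image_congr fun y hy => (atomUnit_of_ne_one (hS y hy)).symm

lemma unitGrading_eq_span {S : ZMod 2 → Set Atom} (hS : ∀ d, ∀ y ∈ S d, y ≠ .one)
    (h : ∀ d, 𝒜 d = Submodule.span F (atomAlg F K '' S d)) (d : ZMod 2) :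
    unitGrading 𝒜 d =
      Submodule.span F (atomUnit F K '' {y | (y = .one ∧ d = 0) ∨ y ∈ S d}) := by
  rw [unitGrading, h d, map_inr_span _ (hS d)]
  split_ifs with hd
  · have : {y : Atom | (y = .one ∧ d = 0) ∨ y ∈ S d} = S d ∪ {.one} := by
      ext y
      simp [hd]
    rw [this, Set.image_union, Submodule.span_union, Set.image_singleton]
    rfl
  · simp [hd]

/-- Graded identities as identities with prescribed substitutions. -/
lemma gradedIdentities_eq {B : Type*} [NonUnitalNonAssocRing B] [Module F B] [IsScalarTower F B B]
    [SMulCommClass F B B] (ℬ : ZMod 2 → Submodule F B) :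
    gradedIdentities ℬ = identitiesOn (Sum.elim (fun _ => ℬ 0) fun _ => ℬ 1) := by
  ext f
  refine forall_congr' fun φ => ?_
  rw [Sum.forall, and_imp]
  rfl

lemma identities_eq {B : Type*} [NonUnitalNonAssocRing B] [Module F B] [IsScalarTower F B B]
    [SMulCommClass F B B] : identities F B = identitiesOn fun _ => (⊤ : Submodule F B) := by
  ext f
  refine forall_congr' fun φ => ?_
  simp

lemma span_gradedSubst (bas : Atom → Unitization F (Alg F K)) (T : ZMod 2 → Set Atom) :
    (fun x => Submodule.span F (bas '' gradedSubst T x)) =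
      Sum.elim (fun _ => Submodule.span F (bas '' T 0)) fun _ => Submodule.span F (bas '' T 1) := by
  funext x
  cases x <;> rfl

/-- The inclusion of a nonassociative algebra in its unitization. -/
def inrAlgHom (F A : Type*) [Field F] [NonUnitalNonAssocRing A] [Module F A] :
    A →ₙₐ[F] Unitization F A where
  toFun := Unitization.inr
  map_smul' := Unitization.inr_smul F
  map_zero' := Unitization.inr_zero F
  map_add' := Unitization.inr_add F
  map_mul' := Unitization.inr_mul F

lemma inrAlgHom_coe : ((inrAlgHom F (Alg F K) : Alg F K →ₙₐ[F] Unitization F (Alg F K)) :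
    Alg F K →ₗ[F] Unitization F (Alg F K)) = Unitization.inrHom F F (Alg F K) := rfl

lemma partialCodim_eq_substCodim {S : ZMod 2 → Set Atom} (hS : ∀ d, ∀ y ∈ S d, y ≠ .one)
    (h : ∀ d, 𝒜 d = Submodule.span F (atomAlg F K '' S d)) (k l : ℕ) :
    partialCodim 𝒜 k l = substCodim F (atomUnit F K) S k l := by
  have e : gradedIdentities 𝒜 =
      identitiesOn fun x => Submodule.span F (atomUnit F K '' gradedSubst S x) := by
    rw [gradedIdentities_eq, span_gradedSubst,
      ← identitiesOn_map (inrAlgHom F (Alg F K)) Unitization.inr_injective]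
    congr 1
    funext x
    rw [inrAlgHom_coe]
    cases x with
    | inl _ => exact (congrArg _ (h 0)).trans (map_inr_span _ (hS 0))
    | inr _ => exact (congrArg _ (h 1)).trans (map_inr_span _ (hS 1))
  rw [partialCodim, e]
  rfl

lemma partialCodim_unit_eq_substCodim {S : ZMod 2 → Set Atom} (hS : ∀ d, ∀ y ∈ S d, y ≠ .one)
    (h : ∀ d, 𝒜 d = Submodule.span F (atomAlg F K '' S d)) (k l : ℕ) :
    partialCodim (unitGrading 𝒜) k l = substCodim F (atomUnit F K)
      (fun d => {y | (y = .one ∧ d = 0) ∨ y ∈ S d}) k l := by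
  have e : gradedIdentities (unitGrading 𝒜) =
      identitiesOn fun x => Submodule.span F (atomUnit F K ''
        gradedSubst (fun d => {y | (y = .one ∧ d = 0) ∨ y ∈ S d}) x) := by
    rw [gradedIdentities_eq, span_gradedSubst, unitGrading_eq_span hS h, unitGrading_eq_span hS h]
  rw [partialCodim, e]
  rfl

lemma identities_alg_eq (hK : ∀ i, 0 < K i) : identities F (Alg F K) =
    identitiesOn fun _ => Submodule.span F (atomUnit F K '' {y | y ≠ .one}) := by
  rw [identities_eq,
    ← identitiesOn_map (inrAlgHom F (Alg F K)) Unitization.inr_injective,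
    inrAlgHom_coe, ← span_atomAlg hK, map_inr_span {y | y ≠ .one} fun _ h => h]

end Algebra

/-! ### Growth of the bounds and conclusion -/

section Growth

variable {c : ℕ → Bool} {p D : ℝ} {C : ℕ}

lemma exists_sum_subwords_le (hp0 : 0 < p) (hp : p ≤ 1 / 2)
    (hC : ∀ n, (subwords c n).card ≤ C * (n + 1))
    (hD : ∀ t n, |(trues c t n : ℝ) - n * p| ≤ D) :
    ∃ Q > 0, ∀ j, ((∑ W ∈ subwords c j, 2 * j.choose (W.count true) : ℕ) : ℝ) ≤
      Q * (j + 1) * Phi p ^ j := by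
  have hq : 0 < ((1 - p) / p) ^ D := Real.rpow_pos_of_pos (div_pos (by linarith) hp0) _
  have hΦ : 0 < Phi p := one_pos.trans_le (one_le_Phi hp0.le (by linarith))
  refine ⟨2 * (C + 1) * ((1 - p) / p) ^ D, by positivity, fun j => ?_⟩
  have h1 : ∀ W ∈ subwords c j, (2 * j.choose (W.count true) : ℝ) ≤
      2 * (((1 - p) / p) ^ D * Phi p ^ j) := by
    intro W hW
    obtain ⟨t, rfl⟩ := mem_subwords.mp hW
    have := choose_le_mul_Phi_pow hp0 hp (trues_le c t j) (hD t j)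
    exact mul_le_mul_of_nonneg_left this (by norm_num)
  push_cast
  refine (Finset.sum_le_sum h1).trans ?_
  rw [Finset.sum_const, nsmul_eq_mul]
  have h2 : ((subwords c j).card : ℝ) ≤ (C + 1) * (j + 1) := by
    have : ((subwords c j).card : ℝ) ≤ C * (j + 1) := by exact_mod_cast hC j
    nlinarith [Nat.cast_nonneg (α := ℝ) j]
  calc ((subwords c j).card : ℝ) * (2 * (((1 - p) / p) ^ D * Phi p ^ j))
      ≤ ((C + 1) * (j + 1)) * (2 * (((1 - p) / p) ^ D * Phi p ^ j)) := by gcongr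
    _ = _ := by ring

lemma exists_card_patterns_le (hp0 : 0 < p) (hp : p ≤ 1 / 2)
    (hC : ∀ n, (subwords c n).card ≤ C * (n + 1))
    (hD : ∀ t n, |(trues c t n : ℝ) - n * p| ≤ D) (deg : Atom → ZMod 2) :
    ∃ Q > 0, ∀ n, 0 < n →
      ((patterns c deg fun i : Fin n => {Finset.univ.erase i}).card : ℝ) ≤
        Q * (n : ℝ) ^ 2 * Phi p ^ n := by
  obtain ⟨Q, hQ, h⟩ := exists_sum_subwords_le hp0 hp hC hD
  have hΦ : 1 ≤ Phi p := one_le_Phi hp0.le (by linarith)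
  refine ⟨3 + Q, by positivity, fun n hn => ?_⟩
  have h1 := card_patterns_le c deg fun i : Fin n => {Finset.univ.erase i}
  have h2 : ∀ i : Fin n, (Finset.univ.erase i).card = n - 1 := fun i => by
    rw [Finset.card_erase_of_mem (Finset.mem_univ i), Finset.card_univ, Fintype.card_fin]
  simp only [Finset.sum_singleton, h2, Finset.sum_const, Finset.card_univ, Fintype.card_fin,
    smul_eq_mul] at h1
  have h3 : ((patterns c deg fun i : Fin n => {Finset.univ.erase i}).card : ℝ) ≤ 3 * n +
      n * ((∑ W ∈ subwords c (n - 1), 2 * (n - 1).choose (W.count true) : ℕ) : ℝ) := by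
    exact_mod_cast h1
  have hn1 : (1 : ℝ) ≤ n := by exact_mod_cast hn
  have h4 := h (n - 1)
  rw [Nat.cast_sub (show 1 ≤ n from hn), Nat.cast_one, sub_add_cancel] at h4
  have h5 : Phi p ^ (n - 1) ≤ Phi p ^ n := pow_le_pow_right₀ hΦ (by omega)
  have h6 : 1 ≤ Phi p ^ n := one_le_pow₀ hΦ
  calc _ ≤ _ := h3
    _ ≤ 3 * ((n : ℝ) ^ 2 * Phi p ^ n) + n * (Q * n * Phi p ^ n) := by
        refine add_le_add ?_ ?_
        · have : (n : ℝ) * 1 ≤ n ^ 2 * Phi p ^ n := by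
            refine mul_le_mul ?_ h6 zero_le_one (by positivity)
            nlinarith
          linarith
        · refine mul_le_mul_of_nonneg_left (h4.trans ?_) (by positivity)
          gcongr
    _ = _ := by ring

lemma exists_card_patterns_univ_le (hp0 : 0 < p) (hp : p ≤ 1 / 2)
    (hC : ∀ n, (subwords c n).card ≤ C * (n + 1))
    (hD : ∀ t n, |(trues c t n : ℝ) - n * p| ≤ D) (deg : Atom → ZMod 2) :
    ∃ Q > 0, ∀ n, 0 < n →
      ((patterns c deg fun _ : Fin n => Finset.univ).card : ℝ) ≤
        Q * (n : ℝ) ^ 2 * (Phi p + 1) ^ n := by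
  obtain ⟨Q, hQ, h⟩ := exists_sum_subwords_le hp0 hp hC hD
  have hΦ : 1 ≤ Phi p := one_le_Phi hp0.le (by linarith)
  refine ⟨3 + 2 * Q, by positivity, fun n hn => ?_⟩
  have h1 := card_patterns_le c deg fun _ : Fin n => Finset.univ
  simp only [Finset.sum_const, Finset.card_univ, Fintype.card_fin, smul_eq_mul] at h1
  have h3 : ((patterns c deg fun _ : Fin n => Finset.univ).card : ℝ) ≤ 3 * n +
      n * ∑ U : Finset (Fin n),
        ((∑ W ∈ subwords c U.card, 2 * U.card.choose (W.count true) : ℕ) : ℝ) := by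
    exact_mod_cast h1
  have hn1 : (1 : ℝ) ≤ n := by exact_mod_cast hn
  have h4 : ∑ U : Finset (Fin n),
      ((∑ W ∈ subwords c U.card, 2 * U.card.choose (W.count true) : ℕ) : ℝ) ≤
      ∑ U : Finset (Fin n), (Q * (n + 1)) * Phi p ^ U.card := by
    refine Finset.sum_le_sum fun U _ => (h U.card).trans ?_
    have h5 : (U.card : ℝ) ≤ n := by
      have := Finset.card_le_univ U
      rw [Fintype.card_fin] at this
      exact_mod_cast this
    gcongr
  have h5 : ∑ U : Finset (Fin n), Phi p ^ U.card = (Phi p + 1) ^ n := by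
    have := Finset.sum_pow_mul_eq_add_pow (Phi p) 1 (Finset.univ : Finset (Fin n))
    rw [Finset.powerset_univ, Finset.card_univ, Fintype.card_fin] at this
    rw [← this]
    simp
  rw [← Finset.mul_sum, h5] at h4
  have h6 : 1 ≤ (Phi p + 1) ^ n := one_le_pow₀ (by linarith)
  calc _ ≤ _ := h3
    _ ≤ 3 * ((n : ℝ) ^ 2 * (Phi p + 1) ^ n) + n * (Q * (2 * n) * (Phi p + 1) ^ n) := by
        refine add_le_add ?_ ?_
        · have : (n : ℝ) * 1 ≤ n ^ 2 * (Phi p + 1) ^ n := by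
            refine mul_le_mul ?_ h6 zero_le_one (by positivity)
            nlinarith
          linarith
        · refine mul_le_mul_of_nonneg_left (h4.trans ?_) (by positivity)
          gcongr
          linarith
    _ = _ := by ring

lemma hasExponent_Phi (hp0 : 0 < p) (hp : p ≤ 1 / 2)
    (hC : ∀ n, (subwords c n).card ≤ C * (n + 1))
    (hD : ∀ t n, |(trues c t n : ℝ) - n * p| ≤ D) (deg : Atom → ZMod 2) {f : ℕ → ℕ}
    (hupper : ∀ n, 0 < n → f n ≤ (patterns c deg fun i : Fin n => {Finset.univ.erase i}).card)
    (hlower : ∀ N, N.choose (trues c 0 N) ≤ f (N + 1)) :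
    HasExponent f (Phi p) := by
  have hΦ : 1 ≤ Phi p := one_le_Phi hp0.le (by linarith)
  refine HasExponent.of_bounds (by linarith) ?_ fun E hE0 hE => ?_
  · obtain ⟨Q, hQ, h⟩ := exists_card_patterns_le hp0 hp hC hD deg
    refine ⟨Q, hQ, 2, ?_⟩
    filter_upwards [eventually_gt_atTop 0] with n hn
    exact (Nat.cast_le.mpr (hupper n hn)).trans (h n hn)
  · obtain ⟨δ, hδ, h⟩ := exists_mul_pow_le_choose hp0.le (by linarith) (trues_le c 0) (hD 0) hE0 hE
    refine ⟨δ / E, by positivity, ?_⟩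
    filter_upwards [eventually_gt_atTop 0] with n hn
    obtain ⟨N, rfl⟩ : ∃ N, n = N + 1 := ⟨n - 1, by omega⟩
    have h1 : δ * E ^ N ≤ f (N + 1) := (h N).trans (by exact_mod_cast hlower N)
    calc δ / E * E ^ (N + 1) = δ * E ^ N := by rw [pow_succ]; field_simp
      _ ≤ 1 * f (N + 1) := by rwa [one_mul]
      _ ≤ _ := by
        gcongr
        simp

lemma hasExponent_Phi_add_one (hp0 : 0 < p) (hp : p ≤ 1 / 2)
    (hC : ∀ n, (subwords c n).card ≤ C * (n + 1))
    (hD : ∀ t n, |(trues c t n : ℝ) - n * p| ≤ D) (deg : Atom → ZMod 2) {f : ℕ → ℕ}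
    (hupper : ∀ n, 0 < n → f n ≤ (patterns c deg fun _ : Fin n => Finset.univ).card)
    (hlower : ∀ N, ∀ j ≤ N, N.choose j * j.choose (trues c 0 j) ≤ f (N + 1)) :
    HasExponent f (Phi p + 1) := by
  have hΦ : 1 ≤ Phi p := one_le_Phi hp0.le (by linarith)
  refine HasExponent.of_bounds (by linarith) ?_ fun E hE0 hE => ?_
  · obtain ⟨Q, hQ, h⟩ := exists_card_patterns_univ_le hp0 hp hC hD deg
    refine ⟨Q, hQ, 2, ?_⟩
    filter_upwards [eventually_gt_atTop 0] with n hn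
    exact (Nat.cast_le.mpr (hupper n hn)).trans (h n hn)
  · obtain ⟨E', h1, h2⟩ := exists_between (show max 0 (E - 1) < Phi p from
      max_lt (by linarith) (by linarith))
    have hE'0 : 0 < E' := (le_max_left _ _).trans_lt h1
    have hE' : E ≤ E' + 1 := by linarith [(le_max_right 0 (E - 1)).trans_lt h1]
    obtain ⟨δ, hδ, h⟩ :=
      exists_mul_pow_le_choose hp0.le (by linarith) (trues_le c 0) (hD 0) hE'0 h2
    refine ⟨δ / E, by positivity, ?_⟩
    filter_upwards [eventually_gt_atTop 0] with n hn
    obtain ⟨N, rfl⟩ : ∃ N, n = N + 1 := ⟨n - 1, by omega⟩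
    have h3 : δ * (E' + 1) ^ N ≤ ∑ j ∈ Finset.range (N + 1), (f (N + 1) : ℝ) := by
      rw [add_pow, Finset.mul_sum]
      refine Finset.sum_le_sum fun j hj => ?_
      have h4 : ((N.choose j * j.choose (trues c 0 j) : ℕ) : ℝ) ≤ f (N + 1) :=
        Nat.cast_le.mpr (hlower N j (by simpa [Nat.lt_succ_iff] using hj))
      rw [Nat.cast_mul] at h4
      refine le_trans ?_ h4
      have h5 := mul_le_mul_of_nonneg_left (h j) (Nat.cast_nonneg (α := ℝ) (N.choose j))
      rw [one_pow, mul_one]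
      linarith
    calc δ / E * E ^ (N + 1) = δ * E ^ N := by rw [pow_succ]; field_simp
      _ ≤ δ * (E' + 1) ^ N := by gcongr
      _ ≤ _ := h3
      _ = _ := by simp

end Growth

section Conclusion

variable {c : ℕ → Bool}

/-- A reading pair that uses all variables leaves none for the unit. -/
lemma pattern_ne_one_of_mem_readingPairs {N : ℕ}
    {p : Σ _ : Finset (Fin (N + 1)), Finset (Fin (N + 1))} (hp : p ∈ readingPairs c N N)
    (i : Fin (N + 1)) : pattern 0 p.1 p.2 (.u 0) i ≠ .one := by
  obtain ⟨⟨h1, h2⟩, -, -⟩ := mem_readingPairs.mp hp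
  have hU : p.1 = Finset.univ.erase 0 := by
    refine Finset.eq_of_subset_of_card_le ?_ ?_
    · exact Finset.subset_erase.mpr ⟨Finset.subset_univ _, h1⟩
    · rw [Finset.card_erase_of_mem (Finset.mem_univ _), Finset.card_univ, Fintype.card_fin, h2]
      rfl
  by_cases hi : i = 0
  · simp [pattern, hi]
  · rw [pattern_eq_ofBool h1 (by rw [hU]; simp [hi])]
    cases decide (i ∈ p.2) <;> simp [Atom.ofBool]

lemma eq_erase_of_forall_ne_one {n : ℕ} {h : Fin n → Atom} (hh : ∀ i, h i ≠ .one) {i₀ : Fin n}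
    {U : Finset (Fin n)} (hU : ∀ i, i ∈ U ↔ i ≠ i₀ ∧ h i ≠ .one) :
    U ∈ ({Finset.univ.erase i₀} : Finset (Finset (Fin n))) := by
  rw [Finset.mem_singleton]
  ext i
  simp [hU, hh]

lemma map_valEmbedding_univ (n : ℕ) :
    Finset.univ.map (Fin.valEmbedding (n := n)) = Finset.range n := by
  ext i
  simp only [Finset.mem_map, Finset.mem_univ, true_and, Fin.valEmbedding_apply, Finset.mem_range]
  exact ⟨fun ⟨j, hj⟩ => hj ▸ j.2, fun hi => ⟨⟨i, hi⟩, rfl⟩⟩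

end Conclusion

end PIAlg

end

theorem theorem5 {F : Type*} [Field F] [CharZero F] (m : ℕ) (hm : 2 ≤ m)
    (w : ℕ → Fin 2) (hw : PIAlg.IsPeriodic w ∨ PIAlg.IsSturmian w)
    (α : ℝ) (hα : PIAlg.HasSlope w α)
    (𝒜 : ZMod 2 → Submodule F (PIAlg.WordAlg F m w))
    (hdecomp : DirectSum.IsInternal 𝒜) (hmul : SetLike.GradedMul 𝒜)
    (ha : SetLike.IsHomogeneousElem 𝒜 (PIAlg.Alg.a F (PIAlg.wordSeq m w)))
    (hb : SetLike.IsHomogeneousElem 𝒜 (PIAlg.Alg.b F (PIAlg.wordSeq m w)))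
    (hz : SetLike.IsHomogeneousElem 𝒜 (PIAlg.Alg.z F (PIAlg.wordSeq m w) 0 0)) :
    PIAlg.HasExponent (PIAlg.gradedCodim 𝒜) (PIAlg.Phi (1 / ((m : ℝ) + α))) ∧
    PIAlg.HasExponent (PIAlg.codim F (PIAlg.WordAlg F m w)) (PIAlg.Phi (1 / ((m : ℝ) + α))) ∧
    PIAlg.HasExponent (PIAlg.gradedCodim (PIAlg.unitGrading 𝒜))
      (PIAlg.Phi (1 / ((m : ℝ) + α)) + 1) := by
  open PIAlg in
  obtain ⟨da, ha⟩ := ha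
  obtain ⟨db, hb⟩ := hb
  obtain ⟨dz, hz⟩ := hz
  have hK : ∀ i, 0 < wordSeq m w i := fun i => by unfold wordSeq; omega
  set c := isLast (wordSeq m w) with hc
  set deg := atomDeg c da db dz with hdeg
  obtain ⟨C₀, hC₀⟩ := exists_isBalanced hw
  obtain ⟨C₁, hC₁⟩ := exists_complexity_le hw
  have hC : ∀ n, (subwords c n).card ≤ ((m + 1) * C₁) * (n + 1) := fun n => by
    rw [mul_assoc]
    exact (card_subwords_le (by omega) n).trans (Nat.mul_le_mul_left _ (hC₁ n))
  have hD := abs_trues_sub_le (m := m) (by omega) hC₀ hα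
  have hm' : (2 : ℝ) ≤ m := by exact_mod_cast hm
  have hα0 := hα.nonneg
  have hp0 : 0 < 1 / ((m : ℝ) + α) := by positivity
  have hp : 1 / ((m : ℝ) + α) ≤ 1 / 2 := one_div_le_one_div_of_le two_pos (by linarith)
  have hB : IsChain F c (atomUnit F (wordSeq m w)) := isChain_atomUnit hK
  let S : ZMod 2 → Set Atom := fun d => {y | y ≠ .one ∧ deg y = d}
  have hS : ∀ d, ∀ y ∈ S d, y ≠ .one := fun d y hy => hy.1
  have h𝒜 : ∀ d, 𝒜 d = Submodule.span F (atomAlg F (wordSeq m w) '' S d) :=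
    grading_eq_span hK hdecomp hmul ha hb hz
  refine ⟨?_, ?_, ?_⟩
  · have hcod : ∀ n, gradedCodim 𝒜 n = ∑ k ∈ Finset.range (n + 1),
        n.choose k * substCodim F (atomUnit F (wordSeq m w)) S k (n - k) := fun n =>
      Finset.sum_congr rfl fun k _ => by rw [partialCodim_eq_substCodim hS h𝒜]
    refine hasExponent_Phi hp0 hp hC hD deg (fun n hn => ?_) fun N => ?_
    · rw [hcod]
      exact hB.sum_substCodim_le deg hn S (fun d y hy => hy.2)
        (fun d t t' ht htt => ⟨by simp, htt.trans ht.2⟩) _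
        fun h hh i₀ U hU => eq_erase_of_forall_ne_one (fun i => (hh i).1) hU
    · rw [hcod]
      have := hB.le_sum_substCodim deg (N := N) (j := N) S (fun d y hy => hy.2)
        (fun d t t' ht htt => ⟨by simp, htt.trans ht.2⟩)
        fun p hp i => ⟨pattern_ne_one_of_mem_readingPairs hp i, rfl⟩
      rwa [Nat.choose_self, one_mul] at this
  · have hcod : ∀ n, codim F (WordAlg F m w) n = Module.finrank F
        (multilinear F (Finset.univ.map (Fin.valEmbedding (n := n))) ⧸
        (identitiesOn fun _ : ℕ => Submodule.span F
          (atomUnit F (wordSeq m w) '' {y | y ≠ .one})).submoduleOf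
          (multilinear F (Finset.univ.map (Fin.valEmbedding (n := n))))) := fun n => by
      rw [map_valEmbedding_univ, ← identities_alg_eq hK]
      rfl
    have hupper : ∀ n, 0 < n → _ := fun n hn =>
      hB.finrank_le deg hn (Fin.valEmbedding (n := n)) (fun _ => {y | y ≠ .one})
        (fun _ t t' _ _ => by simp) (fun i => {Finset.univ.erase i})
        (fun h hh i₀ U hU => eq_erase_of_forall_ne_one hh hU) _ fun h hh _ => hh
    refine hasExponent_Phi hp0 hp hC hD deg (fun n hn => ?_) fun N => ?_
    · rw [hcod]
      exact (hupper n hn).2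
    · rw [hcod]
      have := (hupper (N + 1) N.succ_pos).1
      refine le_of_eq_of_le ?_ (hB.card_le_finrank Fin.valEmbedding (fun _ => {y | y ≠ .one}) N
        (readingPairs c N N) subset_rfl fun p hp i => pattern_ne_one_of_mem_readingPairs hp i)
      rw [card_readingPairs, Nat.choose_self, one_mul]
  · have hcod : ∀ n, gradedCodim (unitGrading 𝒜) n = ∑ k ∈ Finset.range (n + 1),
        n.choose k * substCodim F (atomUnit F (wordSeq m w))
          (fun d => {y | (y = .one ∧ d = 0) ∨ y ∈ S d}) k (n - k) := fun n =>
      Finset.sum_congr rfl fun k _ => by rw [partialCodim_unit_eq_substCodim hS h𝒜]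
    have hdegT : ∀ d, ∀ y ∈ {y | (y = Atom.one ∧ d = 0) ∨ y ∈ S d}, deg y = d := by
      rintro d y (⟨rfl, rfl⟩ | hy)
      exacts [rfl, hy.2]
    have hT : ∀ d t t', Atom.u t ∈ {y | (y = Atom.one ∧ d = 0) ∨ y ∈ S d} →
        deg (.u t') = deg (.u t) → Atom.u t' ∈ {y | (y = Atom.one ∧ d = 0) ∨ y ∈ S d} := by
      rintro d t t' (⟨h, -⟩ | ht) htt
      · simp at h
      · exact Or.inr ⟨by simp, htt.trans ht.2⟩
    refine hasExponent_Phi_add_one hp0 hp hC hD deg (fun n hn => ?_) fun N j _ => ?_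
    · rw [hcod]
      exact hB.sum_substCodim_le deg hn _ hdegT hT _ fun _ _ _ _ _ => Finset.mem_univ _
    · rw [hcod]
      refine hB.le_sum_substCodim deg _ hdegT hT fun p _ i => ?_
      by_cases h : pattern 0 p.1 p.2 (.u 0) i = .one
      · exact Or.inl ⟨h, by rw [h]; rfl⟩
      · exact Or.inr ⟨h, rfl⟩
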